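/- A \emph{graph} is a set $V$ with a reflexive, symmetric edge relation $E\subseteq V^2$. A \emph{topological graph} is a graph whose vertex set is a zero-dimensional compact metrizable space and whose edge relation is closed in $V^2$; finite graphs carry the discrete topology. A set $S\subseteq V$ is \emph{connected} if it is not the union of two nonempty relatively closed subsets $P,Q$ with no edge between a vertex of $P$ and a vertex of $Q$; the \emph{component} of $S$ at $a\in S$ is the union of all connected subsets of $S$ containing $a$. An \emph{epimorphism} is a continuous edge-preserving map that is surjective on vertices and on edges; an epimorphism $f\colon G\to H$ is \emph{confluent} if $f(C)=Q$ for every connected $Q\subseteq V(H)$ and every component $C$ of $f^{-1}(Q)$. Let $\mathcal G$ be the class of nonempty finite connected graphs with confluent epimorphisms. A \emph{projective Fra\"{\i}ss\'e limit} of $\mathcal G$ is a topological graph $\mathbb G$, with vertex set metrized by a compatible metric, such that (1) for every $A\in\mathcal G$ there is a confluent epimorphism $\mathbb G\to A$; (2) for all $A,B\in\mathcal G$ and all confluent epimorphisms $f\colon\mathbb G\to A$ and $g\colon B\to A$ there is a confluent epimorphism $h\colon\mathbb G\to B$ with $f=g\circ h$; (3) for every $\varepsilon>0$ there are $A\in\mathcal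 G$ and a confluent epimorphism $\mathbb G\to A$ all of whose fibres have diameter less than $\varepsilon$. \textbf{Theorem.} A projective Fra\"{\i}ss\'e limit of $\mathcal G$ exists. For every projective Fra\"{\i}ss\'e limit $\mathbb G$ of $\mathcal G$, the edge relation $E(\mathbb G)$ is transitive, hence an equivalence relation, and every point of the topological realization $|\mathbb G|=\mathbb G/E(\mathbb G)$ (with the quotient topology) is the top of a Cantor fan contained in $|\mathbb G|$. That is, for every $x\in|\mathbb G|$ there are a subspace $F\subseteq|\mathbb G|$ and a homeomorphism from the cone $(C\times[0,1])/(C\times\{1\})$ over the Cantor set $C$ onto $F$ that sends the class of $C\times\{1\}$ to $x$. -/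

import Mathlib

namespace ConfluentGraph

universe u v

/-- A reflexive, symmetric and closed edge relation on a topological space `V`.  A *topological
graph* is such a relation on a zero-dimensional compact metrizable space `V`; a *finite graph* is
such a relation on a finite discrete space (there every relation is closed). -/
structure TopologicalGraph (V : Type u) [TopologicalSpace V] where
  /-- `Edge x y` : the pair `⟨x, y⟩` is an edge. -/
  Edge : V → V → Prop
  refl : ∀ x, Edge x x
  symm : ∀ x y, Edge x y → Edge y x
  closed : IsClosed {p : V × V | Edge p.1 p.2}

section Graphs

variable {V : Type u} {W : Type v} [TopologicalSpace V] [TopologicalSpace W]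

/-- `S` is disconnected if it is the union of two nonempty relatively closed subsets `S ∩ P`,
`S ∩ Q` with no edge between them. -/
def TopologicalGraph.IsDisconnectedSet (G : TopologicalGraph V) (S : Set V) : Prop :=
  ∃ P Q : Set V, IsClosed P ∧ IsClosed Q ∧ (S ∩ P).Nonempty ∧ (S ∩ Q).Nonempty ∧
    (S ∩ P) ∪ (S ∩ Q) = S ∧ ∀ a ∈ S ∩ P, ∀ b ∈ S ∩ Q, ¬ G.Edge a b

/-- A set of vertices is connected if it is not disconnected. -/
def TopologicalGraph.IsConnectedSet (G : TopologicalGraph V) (S : Set V) : Prop :=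
  ¬ G.IsDisconnectedSet S

/-- The component of `S` containing `a`: the union of all connected subsets of `S` through `a`. -/
def TopologicalGraph.component (G : TopologicalGraph V) (S : Set V) (a : V) : Set V :=
  ⋃₀ {P : Set V | P ⊆ S ∧ a ∈ P ∧ G.IsConnectedSet P}

/-- An epimorphism of topological graphs: a continuous map that preserves edges and is surjective
both on vertices and on edges. -/
structure IsEpimorphism (G : TopologicalGraph V) (H : TopologicalGraph W) (f : V → W) : Prop where
  continuous : Continuous f
  map_edge : ∀ x y, G.Edge x y → H.Edge (f x) (f y)
  surjective : Function.Surjective f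
  edge_surjective : ∀ u v, H.Edge u v → ∃ x y, G.Edge x y ∧ f x = u ∧ f y = v

/-- A confluent epimorphism: for every connected set `Q` of vertices of the target, every
component of the preimage of `Q` is mapped onto `Q`. -/
structure IsConfluentEpimorphism (G : TopologicalGraph V) (H : TopologicalGraph W)
    (f : V → W) : Prop extends IsEpimorphism G H f where
  confluent : ∀ Q : Set W, H.IsConnectedSet Q →
    ∀ a ∈ f ⁻¹' Q, f '' (G.component (f ⁻¹' Q) a) = Q

end Graphs

/-- A (nonempty) finite connected graph; finite sets carry the discrete topology. -/
structure FiniteConnectedGraph where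
  carrier : Type
  [topology : TopologicalSpace carrier]
  [discrete : DiscreteTopology carrier]
  [finite : Finite carrier]
  [nonempty : Nonempty carrier]
  graph : TopologicalGraph carrier
  connected : graph.IsConnectedSet Set.univ

attribute [instance] FiniteConnectedGraph.topology FiniteConnectedGraph.discrete
  FiniteConnectedGraph.finite FiniteConnectedGraph.nonempty

/-- `G` is a projective Fraïssé limit of the class of finite connected graphs with confluent
epimorphisms.  The three fields are: projective universality, the projective extension property,
and, for every `ε > 0`, an epimorphism onto a member of the class all of whose fibres have diameter
less than `ε`. -/
structure IsProjectiveFraisseLimit {V : Type u} [MetricSpace V] [CompactSpace V]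
    [TotallyDisconnectedSpace V] (G : TopologicalGraph V) : Prop where
  universal : ∀ A : FiniteConnectedGraph, ∃ f : V → A.carrier, IsConfluentEpimorphism G A.graph f
  extension : ∀ (A B : FiniteConnectedGraph) (f : V → A.carrier) (g : B.carrier → A.carrier),
    IsConfluentEpimorphism G A.graph f → IsConfluentEpimorphism B.graph A.graph g →
    ∃ h : V → B.carrier, IsConfluentEpimorphism G B.graph h ∧ f = g ∘ h
  refinement : ∀ ε : ℝ, 0 < ε → ∃ (A : FiniteConnectedGraph) (f : V → A.carrier),
    IsConfluentEpimorphism G A.graph f ∧ ∀ y, Metric.diam (f ⁻¹' {y}) < ε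

/-- The topological realization `|G|`: the quotient of the vertex space by the edge relation, with
the quotient topology.  (It is of interest when the edge relation is transitive, hence an
equivalence relation.) -/
def TopologicalGraph.Realization {V : Type u} [TopologicalSpace V] (G : TopologicalGraph V) :
    Type u :=
  Quot G.Edge

instance {V : Type u} [TopologicalSpace V] (G : TopologicalGraph V) :
    TopologicalSpace G.Realization :=
  inferInstanceAs (TopologicalSpace (Quot G.Edge))

/-- The relation on `C × [0,1]`, with `C = ℕ → Bool` the Cantor set, which identifies all the
points `(x, 1)` with each other. -/
def coneSetoid : Setoid ((ℕ → Bool) × unitInterval) where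
  r p q := p = q ∨ (p.2 = 1 ∧ q.2 = 1)
  iseqv :=
    { refl := fun _ => Or.inl rfl
      symm := by
        rintro p q (h | h)
        · exact Or.inl h.symm
        · exact Or.inr ⟨h.2, h.1⟩
      trans := by
        rintro p q r (rfl | h) (rfl | h')
        · exact Or.inl rfl
        · exact Or.inr h'
        · exact Or.inr h
        · exact Or.inr ⟨h.1, h'.2⟩ }

/-- The Cantor fan: the cone over the Cantor set, with the quotient topology. -/
def CantorFan : Type :=
  Quotient coneSetoid

instance : TopologicalSpace CantorFan :=
  inferInstanceAs (TopologicalSpace (Quotient coneSetoid))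

/-- The top of the Cantor fan: the common class of the points `(x, 1)`. -/
def CantorFan.top : CantorFan :=
  Quotient.mk coneSetoid (fun _ => false, 1)

/-- `x` is the top of a Cantor fan contained in `X`. -/
def IsTopOfCantorFan {X : Type u} [TopologicalSpace X] (x : X) : Prop :=
  ∃ (F : Set X) (e : CantorFan ≃ₜ F), (e CantorFan.top : X) = x

end ConfluentGraph

/-! Between finite connected graphs, an edge-preserving map is confluent exactly when it lifts
edges: from any vertex `b` one can walk inside the fibre of `b` and then cross a prescribed edge at
the image of `b` (`LiftsEdges`).

Existence. Edge lifting passes to components of fibre products, which gives amalgamation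
(`exists_amalgam`). Up to isomorphism there are finitely many extension problems of bounded size
over a fixed graph, so a sequence of finite graphs can be built that eventually solves each one
(`exists_generic_sequence`). In its inverse limit the coordinate projections are confluent, and
every confluent map to a finite graph factors through a stage, so extension problems over the limit
reduce to problems at a stage.

Transitivity. Lifting a fine finite quotient through its edge subdivision (`exists_subdivision`)
forbids three consecutive vertices with distinct images.

Fans. Above a finite quotient, walks from the image of `x` are lifted to a finer quotient with a
uniform delay, then spread apart by a product with a cube (`exists_fan_lift`); the extension
property makes the product a quotient of the limit again. Iterating gives walks indexed by longer
and longer binary words, all starting at the image of `x`. A branch of the Cantor set and a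
proportion of the walk length select one vertex at each stage, compatibly, hence a point of the
limit. Adjacency of consecutive vertices yields continuity in the realization, and non-adjacency of
the others yields injectivity away from the top. -/

namespace ConfluentGraph

universe u v w

open Set Relation Topology

/-! ### Walks, components, and confluence as edge lifting -/

section Walks

variable {V : Type u} {W : Type v} {X : Type w} [TopologicalSpace V] [TopologicalSpace W]
  [TopologicalSpace X]

/-- `y` is reached from `x` by a walk all of whose later vertices are in `S`. -/
def TopologicalGraph.Joined (G : TopologicalGraph V) (S : Set V) : V → V → Prop :=
  ReflTransGen fun u w => G.Edge u w ∧ w ∈ S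

theorem TopologicalGraph.isConnectedSet_of_joined (G : TopologicalGraph V) {S : Set V} {a : V}
    (ha : a ∈ S) (h : ∀ y ∈ S, G.Joined S a y) : G.IsConnectedSet S := by
  have key : ∀ P Q : Set V, (S ∩ P) ∪ (S ∩ Q) = S →
      (∀ a ∈ S ∩ P, ∀ b ∈ S ∩ Q, ¬ G.Edge a b) → (S ∩ Q).Nonempty → a ∉ P := by
    intro P Q hPQ hE ⟨b, hb⟩ haP
    have hall : ∀ y, G.Joined S a y → y ∈ S ∩ P := by
      intro y hy
      induction hy with
      | refl => exact ⟨ha, haP⟩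
      | tail _ hstep ih =>
        rcases hPQ.symm.subset hstep.2 with h1 | h1
        · exact h1
        · exact absurd hstep.1 (hE _ ih _ h1)
    exact hE b (hall b (h b hb.1)) b hb (G.refl b)
  rintro ⟨P, Q, -, -, hP, hQ, hPQ, hE⟩
  rcases hPQ.symm.subset ha with h1 | h1
  · exact key P Q hPQ hE hQ h1.2
  · exact key Q P (by rw [union_comm, hPQ]) (fun a ha b hb hab => hE b hb a ha (G.symm _ _ hab))
      hP h1.2

theorem TopologicalGraph.isConnectedSet_pair (G : TopologicalGraph V) {a b : V}
    (h : G.Edge a b) : G.IsConnectedSet {a, b} := by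
  refine G.isConnectedSet_of_joined (mem_insert a {b}) ?_
  rintro y (rfl | rfl)
  · exact ReflTransGen.refl
  · exact ReflTransGen.single ⟨h, by simp⟩

/-- The vertices reached from `f x` inside `f '' P` form a clopen set of the discrete target. If it
missed `f y`, its preimage and that of its complement would disconnect `P`. -/
theorem TopologicalGraph.IsConnectedSet.joined_image [DiscreteTopology W]
    {G : TopologicalGraph V} {H : TopologicalGraph W} {f : V → W} (hf : Continuous f)
    (hE : ∀ x y, G.Edge x y → H.Edge (f x) (f y)) {P : Set V} (hP : G.IsConnectedSet P)
    {x y : V} (hx : x ∈ P) (hy : y ∈ P) : H.Joined (f '' P) (f x) (f y) := by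
  by_contra hxy
  refine hP ⟨f ⁻¹' {w | H.Joined (f '' P) (f x) w}, f ⁻¹' {w | H.Joined (f '' P) (f x) w}ᶜ,
    (isClosed_discrete _).preimage hf, (isClosed_discrete _).preimage hf,
    ⟨x, hx, ReflTransGen.refl⟩, ⟨y, hy, hxy⟩, ?_, ?_⟩
  · rw [← inter_union_distrib_left, ← preimage_union, union_compl_self, preimage_univ, inter_univ]
  · rintro a ⟨-, ha⟩ b ⟨hbP, hb⟩ hab
    exact hb (ReflTransGen.tail ha ⟨hE _ _ hab, mem_image_of_mem f hbP⟩)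

theorem TopologicalGraph.IsConnectedSet.joined [DiscreteTopology V] {G : TopologicalGraph V}
    {P : Set V} (hP : G.IsConnectedSet P) {x y : V} (hx : x ∈ P) (hy : y ∈ P) :
    G.Joined P x y := by
  simpa using hP.joined_image (f := id) (H := G) continuous_id (fun _ _ h => h) hx hy

theorem TopologicalGraph.component_subset (G : TopologicalGraph V) (S : Set V) (a : V) :
    G.component S a ⊆ S :=
  sUnion_subset fun _ h => h.1

theorem TopologicalGraph.component_mono (G : TopologicalGraph V) {S T : Set V} (h : S ⊆ T)
    (a : V) : G.component S a ⊆ G.component T a :=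
  sUnion_subset_sUnion fun _ hP => ⟨hP.1.trans h, hP.2⟩

theorem TopologicalGraph.mem_component_self (G : TopologicalGraph V) {S : Set V} {a : V}
    (ha : a ∈ S) : a ∈ G.component S a := by
  refine mem_sUnion.2 ⟨{a}, ⟨singleton_subset_iff.2 ha, rfl, ?_⟩, rfl⟩
  simpa using G.isConnectedSet_pair (G.refl a)

/-- All sets in the union pass through `a`, so a separation of the union with `a` on one side
already separates a member that reaches the other side. -/
theorem TopologicalGraph.isConnectedSet_component (G : TopologicalGraph V) (S : Set V) (a : V) :
    G.IsConnectedSet (G.component S a) := by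
  have key : ∀ P Q : Set V, IsClosed P → IsClosed Q →
      (G.component S a ∩ P) ∪ (G.component S a ∩ Q) = G.component S a →
      (∀ x ∈ G.component S a ∩ P, ∀ y ∈ G.component S a ∩ Q, ¬ G.Edge x y) →
      (G.component S a ∩ Q).Nonempty → a ∉ P := by
    rintro P Q hPc hQc hPQ hE ⟨b, ⟨T, hT, hbT⟩, hbQ⟩ haP
    have hTC : T ⊆ G.component S a := subset_sUnion_of_mem hT
    refine hT.2.2 ⟨P, Q, hPc, hQc, ⟨a, hT.2.1, haP⟩, ⟨b, hbT, hbQ⟩, ?_, ?_⟩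
    · rw [← inter_union_distrib_left] at hPQ ⊢
      exact inter_eq_left.2 fun z hz => (hPQ.symm.subset (hTC hz)).2
    · exact fun x hx y hy => hE x ⟨hTC hx.1, hx.2⟩ y ⟨hTC hy.1, hy.2⟩
  rintro ⟨P, Q, hPc, hQc, hP, hQ, hPQ, hE⟩
  have ha : a ∈ G.component S a := by
    obtain ⟨b, ⟨T, hT, hbT⟩, -⟩ := hP
    exact ⟨T, hT, hT.2.1⟩
  rcases hPQ.symm.subset ha with h1 | h1
  · exact key P Q hPc hQc hPQ hE hQ h1.2
  · exact key Q P hQc hPc (by rw [union_comm, hPQ])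
      (fun a ha b hb hab => hE b hb a ha (G.symm _ _ hab)) hP h1.2

/-- Every edge at `g b` lifts to an edge at a vertex joined to `b` within the fibre of `b`. -/
def LiftsEdges (G : TopologicalGraph V) (H : TopologicalGraph W) (g : V → W) : Prop :=
  ∀ b v, H.Edge (g b) v → ∃ b' y, G.Joined (g ⁻¹' {g b}) b b' ∧ G.Edge b' y ∧ g y = v

/-- Onto a connected discrete graph, confluence gives surjectivity on vertices and on edges. -/
theorem IsConfluentEpimorphism.of_confluent [DiscreteTopology W] [Nonempty V]
    {G : TopologicalGraph V} {H : TopologicalGraph W} {f : V → W} (hc : Continuous f)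
    (hE : ∀ x y, G.Edge x y → H.Edge (f x) (f y)) (hH : H.IsConnectedSet univ)
    (hf : ∀ Q : Set W, H.IsConnectedSet Q → ∀ a ∈ f ⁻¹' Q, Q ⊆ f '' (G.component (f ⁻¹' Q) a)) :
    IsConfluentEpimorphism G H f := by
  have hs : Function.Surjective f := fun w => by
    obtain ⟨y, -, hy⟩ := hf univ hH (Classical.arbitrary V) (mem_univ _) (mem_univ w)
    exact ⟨y, hy⟩
  refine ⟨⟨hc, hE, hs, ?_⟩, fun Q hQ a ha => Subset.antisymm ?_ (hf Q hQ a ha)⟩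
  · intro u v huv
    obtain ⟨x, rfl⟩ := hs u
    obtain ⟨y, ⟨P, ⟨hPQ, hxP, hPc⟩, hyP⟩, rfl⟩ :=
      hf _ (H.isConnectedSet_pair huv) x (mem_insert _ _) (mem_insert_of_mem _ rfl)
    by_contra hne
    refine hPc ⟨f ⁻¹' {f x}, f ⁻¹' {f y}, (isClosed_discrete _).preimage hc,
      (isClosed_discrete _).preimage hc, ⟨x, hxP, rfl⟩, ⟨y, hyP, rfl⟩, ?_, ?_⟩
    · rw [← inter_union_distrib_left, ← preimage_union]
      exact inter_eq_left.2 hPQ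
    · exact fun a ha b hb hab => hne ⟨a, b, hab, ha.2, hb.2⟩
  · rintro _ ⟨y, hy, rfl⟩
    exact G.component_subset _ _ hy

/-- A walk inside a connected `Q` lifts step by step without leaving `g ⁻¹' Q`, since the detour
before each crossing stays in a fibre over `Q`. -/
theorem LiftsEdges.isConfluentEpimorphism [DiscreteTopology V] [DiscreteTopology W] [Nonempty V]
    {G : TopologicalGraph V} {H : TopologicalGraph W} {g : V → W} (hg : LiftsEdges G H g)
    (hE : ∀ x y, G.Edge x y → H.Edge (g x) (g y)) (hH : H.IsConnectedSet univ) :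
    IsConfluentEpimorphism G H g := by
  refine .of_confluent continuous_of_discreteTopology hE hH fun Q hQ a ha q hq => ?_
  have key : ∀ q, H.Joined Q (g a) q → ∃ y, G.Joined (g ⁻¹' Q) a y ∧ y ∈ g ⁻¹' Q ∧ g y = q := by
    intro q hq
    induction hq with
    | refl => exact ⟨a, ReflTransGen.refl, ha, rfl⟩
    | tail _ hstep ih =>
      obtain ⟨y, hy, hyQ, rfl⟩ := ih
      obtain ⟨b', z, hb', hz, rfl⟩ := hg y _ hstep.1
      refine ⟨z, ReflTransGen.tail (hy.trans (ReflTransGen.mono ?_ _ _ hb')) ⟨hz, hstep.2⟩,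
        hstep.2, rfl⟩
      rintro s t ⟨hst, ht⟩
      exact ⟨hst, by rw [mem_preimage, show g t = g y from ht]; exact hyQ⟩
  obtain ⟨y, hy, hyQ, rfl⟩ := key q (hQ.joined ha hq)
  refine ⟨y, mem_sUnion.2 ⟨{z | G.Joined (g ⁻¹' Q) a z ∧ z ∈ g ⁻¹' Q},
    ⟨fun z hz => hz.2, ⟨ReflTransGen.refl, ha⟩, ?_⟩, hy, hyQ⟩, rfl⟩
  refine G.isConnectedSet_of_joined (a := a) ⟨ReflTransGen.refl, ha⟩ ?_
  rintro z ⟨hz, -⟩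
  induction hz with
  | refl => exact ReflTransGen.refl
  | tail h1 hstep ih => exact ReflTransGen.tail ih ⟨hstep.1, ReflTransGen.tail h1 hstep, hstep.2⟩

/-- If `g ∘ f'` is confluent and `f'` is an epimorphism, then `g` lifts edges. -/
theorem IsConfluentEpimorphism.liftsEdges_of_comp [DiscreteTopology W]
    {G : TopologicalGraph V} {K : TopologicalGraph W} {H : TopologicalGraph X} {f : V → X}
    {f' : V → W} {g : W → X} (hf : IsConfluentEpimorphism G H f) (hf' : IsEpimorphism G K f')
    (h : f = g ∘ f') : LiftsEdges K H g := by
  intro b v hv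
  obtain ⟨x, rfl⟩ := hf'.surjective b
  have hfx : ∀ x, f x = g (f' x) := fun x => congrFun h x
  -- The component at `x` over the connected pair `{g (f' x), v}` reaches the fibre of `v`. Its
  -- image under `f'` contains a walk there, whose first step out of the fibre of `g (f' x)`, if
  -- any, lands over `v`.
  have him := hf.confluent _ (H.isConnectedSet_pair hv) x
    (by rw [mem_preimage, hfx]; exact mem_insert _ _)
  obtain ⟨y, ⟨P, ⟨hPQ, hxP, hPc⟩, hyP⟩, hyv⟩ := him.symm.subset (mem_insert_of_mem _ rfl)
  have hj := hPc.joined_image hf'.continuous hf'.map_edge hxP hyP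
  have key : ∀ z, K.Joined (f' '' P) (f' x) z → K.Joined (g ⁻¹' {g (f' x)}) (f' x) z ∨
      ∃ b' y, K.Joined (g ⁻¹' {g (f' x)}) (f' x) b' ∧ K.Edge b' y ∧ g y = v := by
    intro z hz
    induction hz with
    | refl => exact Or.inl ReflTransGen.refl
    | tail _ hstep ih =>
      rcases ih with ih | ih
      · obtain ⟨hst, p, hp, rfl⟩ := hstep
        have h2 := hPQ hp
        rw [mem_preimage, hfx] at h2
        rcases h2 with h2 | h2
        · exact Or.inl (ReflTransGen.tail ih ⟨hst, h2⟩)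
        · exact Or.inr ⟨_, _, ih, hst, h2⟩
      · exact Or.inr ih
  rcases key _ hj with h1 | h1
  · exact ⟨_, _, h1, K.refl _, by rw [← hfx, hyv]⟩
  · exact h1

theorem IsConfluentEpimorphism.liftsEdges [DiscreteTopology V]
    {G : TopologicalGraph V} {H : TopologicalGraph W} {g : V → W}
    (hg : IsConfluentEpimorphism G H g) : LiftsEdges G H g :=
  hg.liftsEdges_of_comp (f' := id) (K := G) ⟨continuous_id, fun _ _ h => h,
    Function.surjective_id, fun u v h => ⟨u, v, h, rfl, rfl⟩⟩ rfl

theorem IsConfluentEpimorphism.comp {G : TopologicalGraph V} {K : TopologicalGraph W}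
    {H : TopologicalGraph X} {f : V → W} {g : W → X} (hg : IsConfluentEpimorphism K H g)
    (hf : IsConfluentEpimorphism G K f) : IsConfluentEpimorphism G H (g ∘ f) := by
  refine ⟨⟨hg.continuous.comp hf.continuous, fun x y h => hg.map_edge _ _ (hf.map_edge _ _ h),
    hg.surjective.comp hf.surjective, fun u v h => ?_⟩, fun Q hQ a ha => Subset.antisymm ?_ ?_⟩
  · obtain ⟨s, t, hst, rfl, rfl⟩ := hg.edge_surjective u v h
    obtain ⟨x, y, hxy, rfl, rfl⟩ := hf.edge_surjective _ _ hst
    exact ⟨x, y, hxy, rfl, rfl⟩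
  · rintro _ ⟨y, hy, rfl⟩
    exact G.component_subset _ _ hy
  · have h1 := hg.confluent Q hQ (f a) ha
    have h2 := hf.confluent _ (K.isConnectedSet_component (g ⁻¹' Q) (f a)) a
      (K.mem_component_self ha)
    calc Q = g '' (f '' _) := by rw [h2, h1]
      _ ⊆ (g ∘ f) '' G.component (g ∘ f ⁻¹' Q) a := by
        rw [← image_comp]
        exact image_mono (G.component_mono (preimage_mono (K.component_subset _ _)) a)

/-- A map to a connected discrete graph through which a confluent epimorphism factors after an
epimorphism is confluent. -/
theorem IsConfluentEpimorphism.of_comp [DiscreteTopology W] [DiscreteTopology X] [Nonempty W]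
    {G : TopologicalGraph V} {K : TopologicalGraph W} {H : TopologicalGraph X} {f : V → X}
    {f' : V → W} {g : W → X} (hf : IsConfluentEpimorphism G H f) (hf' : IsEpimorphism G K f')
    (h : f = g ∘ f') (hH : H.IsConnectedSet univ) : IsConfluentEpimorphism K H g := by
  refine (hf.liftsEdges_of_comp hf' h).isConfluentEpimorphism (fun s t hst => ?_) hH
  obtain ⟨x, y, hxy, rfl, rfl⟩ := hf'.edge_surjective s t hst
  have := hf.map_edge _ _ hxy
  rwa [h] at this

end Walks

/-! ### Finite connected graphs: amalgamation, subdivision, cubes -/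

/-- The finite connected graph given by a relation all of whose vertices are reached from one. -/
def FiniteConnectedGraph.ofRel (T : Type) [Finite T] [Nonempty T] (E : T → T → Prop)
    (hr : ∀ x, E x x) (hs : ∀ x y, E x y → E y x) (hc : ∃ a, ∀ y, ReflTransGen E a y) :
    FiniteConnectedGraph :=
  letI : TopologicalSpace T := ⊥
  haveI : DiscreteTopology T := ⟨rfl⟩
  { carrier := T
    graph := ⟨E, hr, hs, isClosed_discrete _⟩
    connected := by
      obtain ⟨a, ha⟩ := hc
      refine TopologicalGraph.isConnectedSet_of_joined _ (mem_univ a) fun y _ => ?_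
      exact ReflTransGen.mono (fun _ _ h => ⟨h, mem_univ _⟩) _ _ (ha y) }

namespace FiniteConnectedGraph

/-- Confluent epimorphisms between finite connected graphs. -/
abbrev Confluent (B A : FiniteConnectedGraph) (g : B.carrier → A.carrier) : Prop :=
  IsConfluentEpimorphism B.graph A.graph g

theorem reflTransGen_edge (A : FiniteConnectedGraph) (x y : A.carrier) :
    ReflTransGen A.graph.Edge x y :=
  ReflTransGen.mono (fun _ _ h => h.1) _ _ (A.connected.joined (mem_univ x) (mem_univ y))

theorem confluent_of_liftsEdges {A B : FiniteConnectedGraph} {g : B.carrier → A.carrier}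
    (hg : LiftsEdges B.graph A.graph g)
    (hE : ∀ x y, B.graph.Edge x y → A.graph.Edge (g x) (g y)) : B.Confluent A g :=
  hg.isConfluentEpimorphism hE A.connected

theorem confluent_id (A : FiniteConnectedGraph) : A.Confluent A id :=
  confluent_of_liftsEdges (fun b v h => ⟨b, v, ReflTransGen.refl, h, rfl⟩) (fun _ _ h => h)

theorem confluent_of_equiv {A B : FiniteConnectedGraph} (e : B.carrier ≃ A.carrier)
    (he : ∀ x y, B.graph.Edge x y ↔ A.graph.Edge (e x) (e y)) : B.Confluent A e :=
  confluent_of_liftsEdges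
    (fun b v h => ⟨b, e.symm v, ReflTransGen.refl, (he _ _).2 (by simpa using h), by simp⟩)
    (fun x y => (he x y).1)

/-- A projection of a pullback lifts edges if the opposite map does. -/
theorem liftsEdges_of_pullback {A B C D : FiniteConnectedGraph} {f : B.carrier → A.carrier}
    {g : C.carrier → A.carrier} {p : D.carrier → B.carrier} {q : D.carrier → C.carrier}
    (hf : ∀ x y, B.graph.Edge x y → A.graph.Edge (f x) (f y))
    (hg : LiftsEdges C.graph A.graph g) (hc : ∀ d, f (p d) = g (q d))
    (hE : ∀ d d', B.graph.Edge (p d) (p d') → C.graph.Edge (q d) (q d') → D.graph.Edge d d')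
    (hD : ∀ d b c, f b = g c → B.graph.Edge (p d) b → C.graph.Edge (q d) c →
      ∃ d', p d' = b ∧ q d' = c) : LiftsEdges D.graph B.graph p := by
  intro d b hb
  obtain ⟨c', c'', h1, h2, h3⟩ := hg (q d) (f b) (by rw [← hc]; exact hf _ _ hb)
  have key : ∀ c, C.graph.Joined (g ⁻¹' {g (q d)}) (q d) c →
      ∃ d', D.graph.Joined (p ⁻¹' {p d}) d d' ∧ q d' = c ∧ p d' = p d := by
    intro c hc'
    induction hc' with
    | refl => exact ⟨d, ReflTransGen.refl, rfl, rfl⟩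
    | @tail c₁ c₂ _ hstep ih =>
      obtain ⟨d', hd', rfl, hp⟩ := ih
      obtain ⟨d'', hp', hq'⟩ := hD d' (p d) c₂ (by rw [hc]; exact hstep.2.symm)
        (by rw [hp]; exact B.graph.refl _) hstep.1
      refine ⟨d'', ReflTransGen.tail hd' ⟨hE _ _ ?_ ?_, hp'⟩, hq', hp'⟩
      · rw [hp, hp']; exact B.graph.refl _
      · rw [hq']; exact hstep.1
  obtain ⟨d', hd', rfl, hp⟩ := key c' h1
  obtain ⟨d'', rfl, hq'⟩ := hD d' b c'' h3.symm (by rwa [hp]) h2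
  exact ⟨d', d'', hd', hE _ _ (by rwa [hp]) (by rwa [hq']), rfl⟩

/-- The class of finite connected graphs with confluent epimorphisms has amalgamation. -/
theorem exists_amalgam {A B C : FiniteConnectedGraph} {f : B.carrier → A.carrier}
    {g : C.carrier → A.carrier} (hf : B.Confluent A f) (hg : C.Confluent A g) :
    ∃ (D : FiniteConnectedGraph) (p : D.carrier → B.carrier) (q : D.carrier → C.carrier),
      D.Confluent B p ∧ D.Confluent C q ∧ f ∘ p = g ∘ q := by
  obtain ⟨b₀⟩ := B.nonempty
  obtain ⟨c₀, hc₀⟩ := hg.surjective (f b₀)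
  let R : B.carrier × C.carrier → B.carrier × C.carrier → Prop := fun x y =>
    B.graph.Edge x.1 y.1 ∧ C.graph.Edge x.2 y.2 ∧ f y.1 = g y.2
  -- The fibre product may be disconnected, so only one component of it is kept.
  let T : Type := {x : B.carrier × C.carrier // f x.1 = g x.2 ∧ ReflTransGen R (b₀, c₀) x}
  let t₀ : T := ⟨(b₀, c₀), hc₀.symm, ReflTransGen.refl⟩
  have : Nonempty T := ⟨t₀⟩
  let E : T → T → Prop := fun x y => B.graph.Edge x.1.1 y.1.1 ∧ C.graph.Edge x.1.2 y.1.2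
  let D : FiniteConnectedGraph := ofRel T E (fun x => ⟨B.graph.refl _, C.graph.refl _⟩)
    (fun x y h => ⟨B.graph.symm _ _ h.1, C.graph.symm _ _ h.2⟩) (by
      refine ⟨t₀, ?_⟩
      have key : ∀ z, ReflTransGen R (b₀, c₀) z → ∃ h, ReflTransGen E t₀ ⟨z, h⟩ := by
        intro z hz
        induction hz with
        | refl => exact ⟨t₀.2, ReflTransGen.refl⟩
        | tail h1 hstep ih =>
          obtain ⟨h, ih⟩ := ih
          exact ⟨⟨hstep.2.2, ReflTransGen.tail h1 hstep⟩,
            ReflTransGen.tail ih ⟨hstep.1, hstep.2.1⟩⟩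
      rintro ⟨y, hy⟩
      exact (key y hy.2).2)
  have hD : ∀ (d : D.carrier) (b : B.carrier) (c : C.carrier), f b = g c →
      B.graph.Edge d.1.1 b → C.graph.Edge d.1.2 c → ∃ d' : D.carrier, d'.1.1 = b ∧ d'.1.2 = c :=
    fun d b c h h1 h2 => ⟨⟨(b, c), h, ReflTransGen.tail d.2.2 ⟨h1, h2, h⟩⟩, rfl, rfl⟩
  have hc : ∀ d : D.carrier, f d.1.1 = g d.1.2 := fun d => d.2.1
  refine ⟨D, fun d => d.1.1, fun d => d.1.2, ?_, ?_, funext hc⟩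
  · exact confluent_of_liftsEdges (liftsEdges_of_pullback hf.map_edge hg.liftsEdges hc
      (fun _ _ h1 h2 => ⟨h1, h2⟩) hD) (fun _ _ h => h.1)
  · exact confluent_of_liftsEdges (liftsEdges_of_pullback (q := fun d : D.carrier => d.1.1)
      hg.map_edge hf.liftsEdges (fun d => (hc d).symm) (fun _ _ h1 h2 => ⟨h2, h1⟩)
      (fun d b c h h1 h2 => (hD d c b h.symm h2 h1).imp fun _ h => h.symm)) (fun _ _ h => h.2)

/-- Subdividing the edges of `A`: some `B` maps confluently onto `A` so that for no vertex `b` of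
`B` two different vertices of `A`, both other than the image of `b`, are images of neighbours
of `b`. -/
theorem exists_subdivision (A : FiniteConnectedGraph) :
    ∃ (B : FiniteConnectedGraph) (g : B.carrier → A.carrier), B.Confluent A g ∧
      ∀ x y z, B.graph.Edge x y → B.graph.Edge y z → g x ≠ g y → g y ≠ g z → g x = g z := by
  -- The loop `(a, a)` stands for the vertex `a`, and `(a, b)` for a point of the edge `ab` next to
  -- `a`: the edge becomes the path `(a, a)`, `(a, b)`, `(b, a)`, `(b, b)`.
  let T : Type := {p : A.carrier × A.carrier // A.graph.Edge p.1 p.2}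
  let c : A.carrier → T := fun a => ⟨(a, a), A.graph.refl a⟩
  have : Nonempty T := A.nonempty.map c
  let E : T → T → Prop := fun x y => x = y ∨ (x.1.1 = y.1.1 ∧ (x.1.2 = x.1.1 ∨ y.1.2 = y.1.1)) ∨
    (x.1.1 = y.1.2 ∧ x.1.2 = y.1.1)
  have hcE : ∀ t : T, E (c t.1.1) t := fun t => Or.inr (Or.inl ⟨rfl, Or.inl rfl⟩)
  have hEc : ∀ t : T, E t (c t.1.1) := fun t => Or.inr (Or.inl ⟨rfl, Or.inr rfl⟩)
  have hsw : ∀ (a b : A.carrier) (h : A.graph.Edge a b),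
      E ⟨(a, b), h⟩ ⟨(b, a), A.graph.symm _ _ h⟩ := fun a b h => Or.inr (Or.inr ⟨rfl, rfl⟩)
  have hcd : ∀ (a b : A.carrier) (h : A.graph.Edge a b), E (c a) ⟨(a, b), h⟩ :=
    fun a b h => hcE ⟨(a, b), h⟩
  let B : FiniteConnectedGraph := ofRel T E (fun x => Or.inl rfl)
    (by
      rintro x y (h | ⟨h1, h2⟩ | ⟨h1, h2⟩)
      · exact Or.inl h.symm
      · exact Or.inr (Or.inl ⟨h1.symm, h2.symm⟩)
      · exact Or.inr (Or.inr ⟨h2.symm, h1.symm⟩)) (by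
      obtain ⟨a⟩ := A.nonempty
      refine ⟨c a, fun y => ReflTransGen.tail ?_ (hcE y)⟩
      generalize y.1.1 = v
      have := A.reflTransGen_edge a v
      induction this with
      | refl => exact ReflTransGen.refl
      | @tail s t _ hst ih =>
        exact ((ih.tail (hcd s t hst)).tail (hsw s t hst)).tail (hEc _))
  refine ⟨B, fun t => t.1.1, confluent_of_liftsEdges ?_ ?_, ?_⟩
  · intro b v h
    exact ⟨⟨(b.1.1, v), h⟩, ⟨(v, b.1.1), A.graph.symm _ _ h⟩,
      (ReflTransGen.single ⟨hEc b, rfl⟩).tail ⟨hcd _ _ h, rfl⟩, hsw _ _ h, rfl⟩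
  · rintro x y (h | ⟨h1, h2⟩ | ⟨h1, h2⟩)
    · rw [h]; exact A.graph.refl _
    · rw [h1]; exact A.graph.refl _
    · rw [h1]; exact A.graph.symm _ _ y.2
  -- Only the swap of `(a, b)` with `(b, a)` changes the first coordinate, so two successive changes
  -- return to `a`.
  · rintro x y z hxy hyz h1 h2
    rcases hxy with h | ⟨h, -⟩ | ⟨h, -⟩
    · exact absurd (by rw [h]) h1
    · exact absurd h h1
    rcases hyz with h' | ⟨h', -⟩ | ⟨-, h'⟩
    · exact absurd (by rw [h']) h2
    · exact absurd h' h2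
    · exact h.trans h'

/-- A product with a cube: some `B` maps confluently onto `A` so that any finitely many walks in `A`
from one vertex lift to walks of `B` from any vertex over it which, up to length `L`, have no edges
between them but at the start. -/
theorem exists_fan_lift (A : FiniteConnectedGraph) (T : Type) [Finite T] (L : ℕ) :
    ∃ (B : FiniteConnectedGraph) (g : B.carrier → A.carrier), B.Confluent A g ∧
      ∀ (q : T → ℕ → A.carrier) (b : B.carrier), (∀ t, q t 0 = g b) →
        (∀ t k, A.graph.Edge (q t k) (q t (k + 1))) →
        ∃ p : T → ℕ → B.carrier, (∀ t, p t 0 = b) ∧ (∀ t k, g (p t k) = q t k) ∧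
          (∀ t k, B.graph.Edge (p t k) (p t (k + 1))) ∧
          ∀ s t k l, k ≤ L → l ≤ L → B.graph.Edge (p s k) (p t l) →
            k ≤ l + 1 ∧ l ≤ k + 1 ∧ (s = t ∨ k = 0 ∨ l = 0) := by
  let X : Type := Set (T × Fin L)
  let E : X → X → Prop := fun x y => (symmDiff x y).Subsingleton
  have hEr : ∀ x, E x x := fun x => by
    change (symmDiff x x).Subsingleton
    rw [symmDiff_self]
    exact Set.subsingleton_empty
  have hEs : ∀ x y, E x y → E y x := fun x y h => by simpa only [E, symmDiff_comm] using h
  have : Nonempty (A.carrier × X) := A.nonempty.map fun a => (a, ∅)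
  let B : FiniteConnectedGraph := ofRel (A.carrier × X)
    (fun x y => A.graph.Edge x.1 y.1 ∧ E x.2 y.2) (fun x => ⟨A.graph.refl _, hEr _⟩)
    (fun x y h => ⟨A.graph.symm _ _ h.1, hEs _ _ h.2⟩) (by
      obtain ⟨a⟩ := A.nonempty
      refine ⟨(a, ∅), ?_⟩
      rintro ⟨y, x⟩
      refine ReflTransGen.trans (b := (y, ∅)) ?_ ?_
      · exact ReflTransGen.lift (fun a => (a, (∅ : X))) (fun _ _ h => ⟨h, hEr _⟩) _ _
          (A.reflTransGen_edge a y)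
      · refine Set.Finite.induction_on x (Set.toFinite x) ReflTransGen.refl ?_
        intro i s _ _ ih
        refine ih.tail ⟨A.graph.refl _, ?_⟩
        refine (Set.subsingleton_singleton (a := i)).anti ?_
        rintro j (⟨h1, h2⟩ | ⟨h1, h2⟩)
        · exact absurd (Set.mem_insert_of_mem _ h1) h2
        · exact h1.resolve_right h2)
  -- In the cube, walk `t` switches on the coordinates of its own block one at a time; the symmetric
  -- difference with `b.2` translates it to start at `b`. After time `L` the block is exhausted,
  -- hence the bound on `k` and `l`.
  let F : T → ℕ → X := fun t k => {i | i.1 = t ∧ i.2.1 < k}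
  refine ⟨B, Prod.fst, confluent_of_liftsEdges ?_ (fun _ _ h => h.1), ?_⟩
  · exact fun b v h => ⟨b, (v, b.2), ReflTransGen.refl, ⟨h, hEr _⟩, rfl⟩
  intro q b hb hq
  have hsd : ∀ s t k l, symmDiff (symmDiff b.2 (F s k)) (symmDiff b.2 (F t l)) =
      symmDiff (F s k) (F t l) := fun s t k l => by
    rw [symmDiff_comm b.2 (F s k), symmDiff_assoc, symmDiff_symmDiff_cancel_left]
  refine ⟨fun t k => (q t k, symmDiff b.2 (F t k)), fun t => ?_, fun _ _ => rfl, fun t k => ?_, ?_⟩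
  · have : F t 0 = ∅ := by simp [F]
    change (q t 0, symmDiff b.2 (F t 0)) = b
    rw [this, hb]
    exact Prod.ext rfl (symmDiff_bot _)
  · refine ⟨hq t k, ?_⟩
    change (symmDiff (symmDiff b.2 (F t k)) (symmDiff b.2 (F t (k + 1)))).Subsingleton
    rw [hsd]
    have hmem : ∀ i ∈ symmDiff (F t k) (F t (k + 1)), i.1 = t ∧ i.2.1 = k := by
      rintro i (⟨h1, h2⟩ | ⟨h1, h2⟩) <;> simp only [F, Set.mem_ofPred_eq] at h1 h2 <;>
        refine ⟨h1.1, ?_⟩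
      · exact absurd ⟨h1.1, h1.2.trans (Nat.lt_succ_self k)⟩ h2
      · have h3 : ¬ i.2.1 < k := fun h => h2 ⟨h1.1, h⟩
        have h4 := h1.2
        omega
    intro i hi j hj
    exact Prod.ext ((hmem i hi).1.trans (hmem j hj).1.symm)
      (Fin.ext ((hmem i hi).2.trans (hmem j hj).2.symm))
  · have hin : ∀ s t k l i, i.1 = s → i.2.1 < k → (s = t → l ≤ i.2.1) →
        i ∈ symmDiff (F s k) (F t l) := fun s t k l i h1 h2 h3 => by
      refine Or.inl ⟨⟨h1, h2⟩, fun h => ?_⟩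
      exact absurd (h3 (h1.symm.trans h.1)) (not_le.2 h.2)
    -- If `k ≥ l + 2`, the coordinates `l` and `l + 1` of block `s` both differ.
    have hle : ∀ s t k l, k ≤ L → l ≤ L → (symmDiff (F s k) (F t l)).Subsingleton →
        k ≤ l + 1 := fun s t k l hk hl h => by
      by_contra hlt
      have := h (hin s t k l (s, ⟨l, by omega⟩) rfl (by simp; omega) (fun _ => le_rfl))
        (hin s t k l (s, ⟨l + 1, by omega⟩) rfl (by simp; omega) (fun _ => by simp))
      simp at this
    rintro s t k l hk hl ⟨-, h⟩
    change (symmDiff (symmDiff b.2 (F s k)) (symmDiff b.2 (F t l))).Subsingleton at h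
    rw [hsd] at h
    refine ⟨hle s t k l hk hl h, hle t s l k hl hk (by rwa [symmDiff_comm]), ?_⟩
    -- For `s ≠ t` at positive times, the first coordinates of both blocks differ.
    by_contra! hne
    have h1 := hin s t k l (s, ⟨0, by omega⟩) rfl (by simp; omega) (fun h => absurd h hne.1)
    have h2 := hin t s l k (t, ⟨0, by omega⟩) rfl (by simp; omega) (fun h => absurd h.symm hne.1)
    rw [symmDiff_comm] at h2
    exact hne.1 (congrArg Prod.fst (h h1 h2))

/-! ### A sequence solving all extension problems -/

/-- A single map onto `C` through which all extension problems with at most `n` vertices on top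
are solved. -/
theorem exists_solution (C : FiniteConnectedGraph) (n : ℕ) :
    ∃ (D : FiniteConnectedGraph) (r : D.carrier → C.carrier), D.Confluent C r ∧
      ∀ (A B : FiniteConnectedGraph) (f : C.carrier → A.carrier) (g : B.carrier → A.carrier),
        C.Confluent A f → B.Confluent A g → Nat.card B.carrier ≤ n →
        ∃ h : D.carrier → B.carrier, D.Confluent B h ∧ f ∘ r = g ∘ h := by
  classical
  -- Whether a map solves the problem depends only on the graph `B` and the relation `f c = g b`, so
  -- `A` can be forgotten. Once the vertices of `B` are numbered, finitely many codes remain.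
  let K : Type := Σ k : Fin (n + 1), (Fin k → Fin k → Prop) × (C.carrier → Fin k → Prop)
  have : Finite K := inferInstance
  let P : K → ∀ A B : FiniteConnectedGraph, (C.carrier → A.carrier) → (B.carrier → A.carrier) →
      Prop := fun κ A B f g => ∃ e : B.carrier ≃ Fin κ.1,
    (∀ u v, B.graph.Edge u v ↔ κ.2.1 (e u) (e v)) ∧ ∀ c b, f c = g b ↔ κ.2.2 c (e b)
  have key : ∀ s : Set K, ∃ (D : FiniteConnectedGraph) (r : D.carrier → C.carrier),
      D.Confluent C r ∧ ∀ κ ∈ s, ∀ (A B : FiniteConnectedGraph) (f : C.carrier → A.carrier)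
        (g : B.carrier → A.carrier), C.Confluent A f → B.Confluent A g → P κ A B f g →
        ∃ h : D.carrier → B.carrier, D.Confluent B h ∧ f ∘ r = g ∘ h := by
    intro s
    refine Set.Finite.induction_on s (Set.toFinite s) ⟨C, id, C.confluent_id, by simp⟩ ?_
    rintro κ s - - ⟨D, r, hr, hD⟩
    by_cases hκ : ∃ (A B : FiniteConnectedGraph) (f : C.carrier → A.carrier)
        (g : B.carrier → A.carrier), C.Confluent A f ∧ B.Confluent A g ∧ P κ A B f g
    · obtain ⟨A₀, B₀, f₀, g₀, hf₀, hg₀, e₀, he₀, hS₀⟩ := hκ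
      obtain ⟨D', p, q, hp, hq, hpq⟩ := exists_amalgam (hf₀.comp hr) hg₀
      refine ⟨D', r ∘ p, hr.comp hp, ?_⟩
      rintro κ' (rfl | hκ') A B f g hf hg hP
      · obtain ⟨e, he, hS⟩ := hP
        refine ⟨(e₀.trans e.symm) ∘ q, (confluent_of_equiv (e₀.trans e.symm) ?_).comp hq, ?_⟩
        · intro x y
          rw [he₀, he]
          simp
        · funext d
          have h1 := congrFun hpq d
          simp only [Function.comp_apply] at h1 ⊢
          rw [hS, Equiv.trans_apply, Equiv.apply_symm_apply, ← hS₀]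
          exact h1
      · obtain ⟨h, hh, hfg⟩ := hD κ' hκ' A B f g hf hg hP
        exact ⟨h ∘ p, hh.comp hp, by rw [← Function.comp_assoc, hfg, Function.comp_assoc]⟩
    · refine ⟨D, r, hr, ?_⟩
      rintro κ' (rfl | hκ') A B f g hf hg hP
      · exact absurd ⟨A, B, f, g, hf, hg, hP⟩ hκ
      · exact hD κ' hκ' A B f g hf hg hP
  obtain ⟨D, r, hr, hD⟩ := key univ
  refine ⟨D, r, hr, fun A B f g hf hg hn => ?_⟩
  let e : B.carrier ≃ Fin (Nat.card B.carrier) := Finite.equivFin B.carrier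
  refine hD ⟨⟨Nat.card B.carrier, Nat.lt_succ_of_le hn⟩,
    fun i j => B.graph.Edge (e.symm i) (e.symm j), fun c i => f c = g (e.symm i)⟩ (mem_univ _) A B f g hf hg ⟨e, ?_, ?_⟩ <;> simp

/-- A sequence of finite connected graphs and confluent epimorphisms in which every extension
problem at every stage is solved at a later stage. -/
theorem exists_generic_sequence :
    ∃ (A : ℕ → FiniteConnectedGraph) (g : ∀ n, (A (n + 1)).carrier → (A n).carrier),
      (∀ n, (A (n + 1)).Confluent (A n) (g n)) ∧ Subsingleton (A 0).carrier ∧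
      ∀ (n : ℕ) (C B : FiniteConnectedGraph) (f : (A n).carrier → C.carrier)
        (k : B.carrier → C.carrier), (A n).Confluent C f → B.Confluent C k →
        Nat.card B.carrier ≤ n →
        ∃ h : (A (n + 1)).carrier → B.carrier, (A (n + 1)).Confluent B h ∧ f ∘ g n = k ∘ h := by
  choose D r hr hD using exists_solution
  let A₀ : FiniteConnectedGraph := ofRel PUnit (fun _ _ => True) (fun _ => trivial)
    (fun _ _ _ => trivial) ⟨PUnit.unit, fun _ => ReflTransGen.refl⟩
  -- The size bound grows with the stage, so every problem is eventually within range.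
  let A : ℕ → FiniteConnectedGraph := fun n => Nat.rec A₀ (fun n C => D C n) n
  exact ⟨A, fun n => r (A n) n, fun n => hr (A n) n, inferInstanceAs (Subsingleton PUnit),
    fun n => hD (A n) n⟩

/-! ### Inverse limits of finite graphs -/

variable {A : ℕ → FiniteConnectedGraph} {g : ∀ n, (A (n + 1)).carrier → (A n).carrier}

/-- The inverse limit of a sequence of finite graphs. -/
abbrev Thread (A : ℕ → FiniteConnectedGraph) (g : ∀ n, (A (n + 1)).carrier → (A n).carrier) :
    Type :=
  {x : ∀ n, (A n).carrier // ∀ n, g n (x (n + 1)) = x n}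

theorem Thread.continuous_apply (n : ℕ) : Continuous fun x : Thread A g => x.1 n :=
  (_root_.continuous_apply n).comp continuous_subtype_val

instance : CompactSpace (Thread A g) := by
  have hc : IsClosed {x : ∀ n, (A n).carrier | ∀ n, g n (x (n + 1)) = x n} := by
    rw [ofPred_forall]
    exact isClosed_iInter fun n => isClosed_eq
      (continuous_of_discreteTopology.comp (_root_.continuous_apply (n + 1)))
      (_root_.continuous_apply n)
  exact isCompact_iff_compactSpace.1 hc.isCompact

theorem exists_prefix (n : ℕ) (a : (A n).carrier) :
    ∃ x : ∀ k, (A k).carrier, x n = a ∧ ∀ k < n, g k (x (k + 1)) = x k := by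
  classical
  induction n with
  | zero => exact ⟨Function.update (fun k => Classical.choice (A k).nonempty) 0 a, by simp, by simp⟩
  | succ n ih =>
    obtain ⟨x, hx, hc⟩ := ih (g n a)
    refine ⟨Function.update x (n + 1) a, by simp, fun k hk => ?_⟩
    rw [Function.update_of_ne (by omega : k ≠ n + 1)]
    rcases (show k < n ∨ k = n by omega) with h | rfl
    · rw [Function.update_of_ne (by omega), hc k h]
    · rw [Function.update_self, hx]

/-- Compatible surjections between sets of vertices have a point in the inverse limit over each
vertex. -/
theorem exists_thread (C : ∀ m, Set (A m).carrier) (n : ℕ)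
    (hC : ∀ m, n ≤ m → C m ⊆ g m '' C (m + 1)) {q : (A n).carrier} (hq : q ∈ C n) :
    ∃ y : Thread A g, y.1 n = q ∧ ∀ m, n ≤ m → y.1 m ∈ C m := by
  classical
  -- Any finite part of the requirements can be met by choosing one coordinate at a time;
  -- compactness meets them all.
  let K : ℕ → Set (∀ k, (A k).carrier) := fun j =>
    {x | x n = q} ∩ ((⋂ k ∈ Iio (n + j), {x | g k (x (k + 1)) = x k}) ∩
      ⋂ k ∈ Icc n (n + j), (fun x => x k) ⁻¹' C k)
  have hmem : ∀ j x, x ∈ K j ↔ x n = q ∧ (∀ k < n + j, g k (x (k + 1)) = x k) ∧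
      ∀ k, n ≤ k → k ≤ n + j → x k ∈ C k := fun j x => by
    simp [K]
  have hne : ∀ j, (K j).Nonempty := by
    intro j
    induction j with
    | zero =>
      obtain ⟨x, hx, hc⟩ := exists_prefix (g := g) n q
      refine ⟨x, (hmem _ _).2 ⟨hx, hc, fun k h1 h2 => ?_⟩⟩
      obtain rfl : k = n := le_antisymm h2 h1
      rwa [hx]
    | succ j ih =>
      obtain ⟨x, hx⟩ := ih
      obtain ⟨h1, h2, h3⟩ := (hmem _ _).1 hx
      obtain ⟨a, haC, ha⟩ := hC (n + j) (by omega) (h3 (n + j) (by omega) le_rfl)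
      refine ⟨Function.update x (n + j + 1) a, (hmem _ _).2 ⟨?_, fun k hk => ?_, fun k hk hk' => ?_⟩⟩
      · rw [Function.update_of_ne (by omega), h1]
      · rw [Function.update_of_ne (by omega : k ≠ n + j + 1)]
        rcases (show k < n + j ∨ k = n + j by omega) with h | rfl
        · rw [Function.update_of_ne (by omega), h2 k h]
        · rw [Function.update_self, ha]
      · rcases (show k ≤ n + j ∨ k = n + j + 1 by omega) with h | h
        · rw [Function.update_of_ne (by omega)]
          exact h3 k hk h
        · subst h
          rw [Function.update_self]
          exact haC
  have hcl : ∀ j, IsClosed (K j) := fun j => by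
    refine (isClosed_eq (continuous_apply n) continuous_const).inter
      (IsClosed.inter (isClosed_biInter fun k _ => isClosed_eq
        (continuous_of_discreteTopology.comp (continuous_apply (k + 1))) (continuous_apply k))
        (isClosed_biInter fun k _ => (isClosed_discrete _).preimage (continuous_apply k)))
  obtain ⟨x, hx⟩ := IsCompact.nonempty_iInter_of_sequence_nonempty_isCompact_isClosed K
    (fun j x hx => by
      rw [hmem] at hx ⊢
      exact ⟨hx.1, fun k hk => hx.2.1 k (by omega), fun k h1 h2 => hx.2.2 k h1 (by omega)⟩)
    hne (hcl 0).isCompact hcl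
  rw [mem_iInter] at hx
  refine ⟨⟨x, fun k => ?_⟩, ((hmem _ _).1 (hx 0)).1, fun m hm => ?_⟩
  · exact ((hmem _ _).1 (hx (k + 1))).2.1 k (by omega)
  · exact ((hmem _ _).1 (hx m)).2.2 m hm (by omega)

/-- The inverse limit of finite graphs as a topological graph. -/
def limitGraph (A : ℕ → FiniteConnectedGraph) (g : ∀ n, (A (n + 1)).carrier → (A n).carrier) :
    TopologicalGraph (Thread A g) where
  Edge x y := ∀ n, (A n).graph.Edge (x.1 n) (y.1 n)
  refl x n := (A n).graph.refl _
  symm x y h n := (A n).graph.symm _ _ (h n)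
  closed := by
    rw [ofPred_forall]
    exact isClosed_iInter fun n => (A n).graph.closed.preimage
      (((Thread.continuous_apply n).comp continuous_fst).prodMk
      ((Thread.continuous_apply n).comp continuous_snd))

/-- The pairs of `Z` related at stage `n` form decreasing compact sets; were none empty, a common
point would be related at every stage. With edges for `R`, separations descend to a finite stage;
with equality, one gets factorizations and small fibres. -/
theorem exists_separating {Z : Set (Thread A g × Thread A g)} (hZ : IsClosed Z)
    {R : ∀ n, (A n).carrier → (A n).carrier → Prop}
    (hR : ∀ n x y, R (n + 1) x y → R n (g n x) (g n y))
    (h : ∀ x y, (x, y) ∈ Z → ¬ ∀ n, R n (x.1 n) (y.1 n)) :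
    ∃ m, ∀ n, m ≤ n → ∀ x y, (x, y) ∈ Z → ¬ R n (x.1 n) (y.1 n) := by
  let K : ℕ → Set (Thread A g × Thread A g) := fun n => Z ∩ {p | R n (p.1.1 n) (p.2.1 n)}
  have hcl : ∀ n, IsClosed (K n) := fun n => hZ.inter
    ((isClosed_discrete {p : (A n).carrier × (A n).carrier | R n p.1 p.2}).preimage
      (((Thread.continuous_apply n).comp continuous_fst).prodMk
        ((Thread.continuous_apply n).comp continuous_snd)))
  have hanti : ∀ n, K (n + 1) ⊆ K n := by
    rintro n ⟨x, y⟩ ⟨h1, h2⟩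
    refine ⟨h1, ?_⟩
    have := hR n _ _ h2
    rwa [x.2, y.2] at this
  by_contra! hne
  have hne' : ∀ n, (K n).Nonempty := fun n => by
    obtain ⟨m, hm, x, y, hxy, hr⟩ := hne n
    exact ⟨(x, y), antitone_nat_of_succ_le hanti hm ⟨hxy, hr⟩⟩
  obtain ⟨⟨x, y⟩, hxy⟩ := IsCompact.nonempty_iInter_of_sequence_nonempty_isCompact_isClosed K
    hanti hne' (hcl 0).isCompact hcl
  rw [mem_iInter] at hxy
  exact h x y (hxy 0).1 fun n => (hxy n).2

/-- Start with `Q` at stage `n` and take, at each later stage, the component of the preimage at the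
coordinate of `x`. Confluence maps each onto the preceding one, so the threads through them surject
onto every stage. They form a connected set, because a separation would already show at a finite
stage. -/
theorem confluent_limitGraph_apply (hg : ∀ n, (A (n + 1)).Confluent (A n) (g n)) (n : ℕ) :
    IsConfluentEpimorphism (limitGraph A g) (A n).graph (fun x => x.1 n) := by
  classical
  have : Nonempty (Thread A g) := by
    obtain ⟨y, -⟩ := exists_thread (g := g) (fun m => univ) 0
      (fun m _ => by rw [image_univ, (hg m).surjective.range_eq])
      (mem_univ (Classical.choice (A 0).nonempty))
    exact ⟨y⟩
  refine .of_confluent (Thread.continuous_apply n) (fun x y h => h n) (A n).connected ?_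
  intro Q hQ x hx q hq
  -- The recursion has to start at `0` although `Q` lives at stage `n`; the values before `n` are
  -- dummies.
  let D : ∀ m, Set (A m).carrier := Function.update (fun m => univ) n Q
  let C : ∀ m, Set (A m).carrier := fun m => Nat.rec (motive := fun m => Set (A m).carrier) (D 0)
    (fun m S => if n ≤ m then (A (m + 1)).graph.component (g m ⁻¹' S) (x.1 (m + 1)) else D (m + 1)) m
  have hCs : ∀ m, n ≤ m → C (m + 1) = (A (m + 1)).graph.component (g m ⁻¹' C m) (x.1 (m + 1)) :=
    fun m hm => if_pos hm
  have hCn : C n = Q := by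
    have hD : D n = Q := Function.update_self ..
    cases n with
    | zero => exact hD
    | succ k => exact (if_neg (by omega)).trans hD
  have hC : ∀ m, n ≤ m → (A m).graph.IsConnectedSet (C m) ∧ x.1 m ∈ C m := by
    intro m hm
    induction m, hm using Nat.le_induction with
    | base => rw [hCn]; exact ⟨hQ, hx⟩
    | succ m hm ih =>
      rw [hCs m hm]
      refine ⟨TopologicalGraph.isConnectedSet_component _ _ _,
        TopologicalGraph.mem_component_self _ ?_⟩
      rw [mem_preimage, x.2]
      exact ih.2
  have hCg : ∀ m, n ≤ m → g m '' C (m + 1) = C m := fun m hm => by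
    rw [hCs m hm]
    refine (hg m).confluent _ (hC m hm).1 _ ?_
    rw [mem_preimage, x.2]
    exact (hC m hm).2
  let P : Set (Thread A g) := {y | ∀ m, n ≤ m → y.1 m ∈ C m}
  have hP : ∀ m, n ≤ m → ∀ c ∈ C m, ∃ y ∈ P, y.1 m = c := by
    intro m hm c hc
    obtain ⟨y, hy, hyC⟩ := exists_thread (g := g) C m
      (fun k hk => (hCg k (hm.trans hk)).symm.subset) hc
    refine ⟨y, fun k hk => ?_, hy⟩
    rcases le_total m k with h | h
    · exact hyC k h
    · have hdown : ∀ j, k ≤ j → y.1 j ∈ C j → y.1 k ∈ C k := by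
        intro j hj
        induction j, hj using Nat.le_induction with
        | base => exact id
        | succ j hj ih =>
          intro h
          refine ih ?_
          rw [← hCg j (hk.trans hj), ← y.2]
          exact mem_image_of_mem _ h
      exact hdown m h (hyC m le_rfl)
  have hPcl : IsClosed P := by
    have : P = ⋂ m ∈ Ici n, (fun y : Thread A g => y.1 m) ⁻¹' C m := by
      ext; simp [P]
    rw [this]
    exact isClosed_biInter fun m _ => (isClosed_discrete _).preimage (Thread.continuous_apply m)
  have hPc : (limitGraph A g).IsConnectedSet P := by
    rintro ⟨K, L, hK, hL, hKne, hLne, hKL, hE⟩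
    obtain ⟨m, hm⟩ := exists_separating (Z := (P ∩ K) ×ˢ (P ∩ L))
      ((hPcl.inter hK).prod (hPcl.inter hL)) (R := fun n => (A n).graph.Edge)
      (fun n => (hg n).map_edge) (fun x y hxy => hE x hxy.1 y hxy.2)
    have hnm : n ≤ max n m := le_max_left _ _
    have himg : ∀ K : Set (Thread A g), C (max n m) ∩ (fun y : Thread A g => y.1 (max n m)) '' (P ∩ K)
        = (fun y : Thread A g => y.1 (max n m)) '' (P ∩ K) := fun K => by
      refine inter_eq_right.2 ?_
      rintro _ ⟨y, hy, rfl⟩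
      exact hy.1 _ hnm
    refine (hC (max n m) hnm).1 ⟨(fun y : Thread A g => y.1 (max n m)) '' (P ∩ K),
      (fun y : Thread A g => y.1 (max n m)) '' (P ∩ L), isClosed_discrete _, isClosed_discrete _,
      ?_, ?_, ?_, ?_⟩
    · rw [himg]; exact hKne.image _
    · rw [himg]; exact hLne.image _
    · rw [himg, himg, ← image_union, hKL]
      ext c
      constructor
      · rintro ⟨y, hy, rfl⟩
        exact hy _ hnm
      · intro hc
        exact hP _ hnm c hc
    · rw [himg, himg]
      rintro _ ⟨y, hy, rfl⟩ _ ⟨z, hz, rfl⟩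
      exact hm _ (le_max_right _ _) y z ⟨hy, hz⟩
  obtain ⟨y, hyP, hy⟩ := hP n le_rfl q (hCn ▸ hq)
  refine ⟨y, mem_sUnion.2 ⟨P, ⟨fun z hz => ?_, fun m hm => (hC m hm).2, hPc⟩, hyP⟩, hy⟩
  have := hz n le_rfl
  rwa [hCn] at this

/-- A confluent map on the limit to a finite graph factors through all sufficiently late stages. -/
theorem exists_factorization (hg : ∀ n, (A (n + 1)).Confluent (A n) (g n))
    {B : FiniteConnectedGraph} {f : Thread A g → B.carrier}
    (hf : IsConfluentEpimorphism (limitGraph A g) B.graph f) :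
    ∃ m, ∀ n, m ≤ n → ∃ f' : (A n).carrier → B.carrier, (A n).Confluent B f' ∧
      f = f' ∘ fun x => x.1 n := by
  obtain ⟨m, hm⟩ := exists_separating (Z := {p | f p.1 ≠ f p.2})
    ((isClosed_discrete {p : B.carrier × B.carrier | p.1 ≠ p.2}).preimage
      ((hf.continuous.comp continuous_fst).prodMk (hf.continuous.comp continuous_snd)))
    (R := fun _ x y => x = y) (fun n x y h => congrArg (g n) h)
    (fun x y hxy h => hxy (congrArg f (Subtype.ext (funext h))))
  refine ⟨m, fun n hn => ?_⟩
  have hs := (confluent_limitGraph_apply hg n).surjective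
  have hfac : f = (f ∘ Function.surjInv hs) ∘ fun x => x.1 n := by
    funext x
    by_contra hne
    exact hm n hn x _ hne (Function.surjInv_eq hs (x.1 n)).symm
  exact ⟨_, hf.of_comp (confluent_limitGraph_apply hg n).toIsEpimorphism hfac B.connected, hfac⟩

end FiniteConnectedGraph

/-! ### Existence of the limit -/

/-- The projective Fraïssé limit of finite connected graphs with confluent epimorphisms exists. -/
theorem exists_isProjectiveFraisseLimit :
    ∃ (V : Type) (_ : MetricSpace V) (_ : CompactSpace V) (_ : TotallyDisconnectedSpace V)
      (G : TopologicalGraph V), IsProjectiveFraisseLimit G := by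
  obtain ⟨A, g, hg, h0, hgen⟩ := FiniteConnectedGraph.exists_generic_sequence
  have hcpt : CompactSpace (FiniteConnectedGraph.Thread A g) := inferInstance
  have htd : TotallyDisconnectedSpace (FiniteConnectedGraph.Thread A g) := inferInstance
  have : SecondCountableTopology (FiniteConnectedGraph.Thread A g) :=
    Topology.IsInducing.subtypeVal.secondCountableTopology
  let _ : MetricSpace (FiniteConnectedGraph.Thread A g) :=
    TopologicalSpace.metrizableSpaceMetric (FiniteConnectedGraph.Thread A g)
  have hpi := FiniteConnectedGraph.confluent_limitGraph_apply hg
  have hext : ∀ (C B : FiniteConnectedGraph)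
      (f : FiniteConnectedGraph.Thread A g → C.carrier) (k : B.carrier → C.carrier),
      IsConfluentEpimorphism (FiniteConnectedGraph.limitGraph A g) C.graph f →
      B.Confluent C k → ∃ h : FiniteConnectedGraph.Thread A g → B.carrier,
        IsConfluentEpimorphism (FiniteConnectedGraph.limitGraph A g) B.graph h ∧ f = k ∘ h := by
    intro C B f k hf hk
    obtain ⟨m, hm⟩ := FiniteConnectedGraph.exists_factorization hg hf
    -- A stage late enough both for `f` to factor and for the size of `B` to be within range.
    obtain ⟨f', hf', hff'⟩ := hm (max m (Nat.card B.carrier)) (le_max_left _ _)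
    obtain ⟨h, hh, hfh⟩ := hgen _ C B f' k hf' hk (le_max_right _ _)
    refine ⟨_, hh.comp (hpi _), ?_⟩
    rw [← Function.comp_assoc, ← hfh, hff']
    funext x
    simp [x.2]
  refine ⟨FiniteConnectedGraph.Thread A g, inferInstance, hcpt, htd,
    FiniteConnectedGraph.limitGraph A g, ⟨fun B => ?_, hext, fun ε hε => ?_⟩⟩
  · obtain ⟨a⟩ := (A 0).nonempty
    -- Over the one-point graph `A 0`, extension is universality.
    obtain ⟨h, hh, -⟩ := hext (A 0) B (fun x => x.1 0) (fun _ => a) (hpi 0)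
      (FiniteConnectedGraph.confluent_of_liftsEdges
        (fun b v _ => ⟨b, b, ReflTransGen.refl, B.graph.refl b, Subsingleton.elim _ _⟩)
        (fun _ _ _ => (A 0).graph.refl _))
    exact ⟨h, hh⟩
  · obtain ⟨m, hm⟩ := FiniteConnectedGraph.exists_separating (A := A) (g := g)
      (Z := {p | ε / 2 ≤ dist p.1 p.2}) (isClosed_le continuous_const continuous_dist)
      (R := fun _ x y => x = y) (fun n x y h => congrArg (g n) h)
      (fun x y hxy h => by
        have hxy' : ε / 2 ≤ dist x y := hxy
        rw [show x = y from Subtype.ext (funext h), dist_self] at hxy'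
        linarith)
    refine ⟨A m, fun x => x.1 m, hpi m, fun a => ?_⟩
    refine lt_of_le_of_lt (Metric.diam_le_of_forall_dist_le (half_pos hε).le ?_) (half_lt_self hε)
    intro x hx y hy
    by_contra hlt
    exact hm m le_rfl x y (not_le.1 hlt).le (Eq.trans hx hy.symm)

/-! ### Lifting walks with a uniform delay -/

/-- A walk of a graph: consecutive vertices are adjacent. -/
def TopologicalGraph.IsWalk {V : Type u} [TopologicalSpace V] (G : TopologicalGraph V)
    (q : ℕ → V) : Prop :=
  ∀ k, G.Edge (q k) (q (k + 1))

theorem TopologicalGraph.IsWalk.edge {V : Type u} [TopologicalSpace V] {G : TopologicalGraph V}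
    {q : ℕ → V} (hq : G.IsWalk q) {k l : ℕ} (h1 : k ≤ l + 1) (h2 : l ≤ k + 1) :
    G.Edge (q k) (q l) := by
  rcases (show k = l ∨ k = l + 1 ∨ l = k + 1 by omega) with rfl | rfl | rfl
  · exact G.refl _
  · exact G.symm _ _ (hq l)
  · exact hq k

/-- Walks lift along a confluent epimorphism with all steps delayed by the same factor. -/
theorem FiniteConnectedGraph.Confluent.exists_walk_lift {A B : FiniteConnectedGraph}
    {g : B.carrier → A.carrier} (hg : B.Confluent A g) :
    ∃ N, 2 ≤ N ∧ ∀ (q : ℕ → A.carrier) (b : B.carrier), A.graph.IsWalk q → g b = q 0 →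
      ∃ q' : ℕ → B.carrier, q' 0 = b ∧ B.graph.IsWalk q' ∧ ∀ k, g (q' k) = q (k / N) := by
  -- Reflexive edges permit waiting, so a walk in the fibre stretches to every sufficiently large
  -- length.
  have hstay : ∀ b c, B.graph.Joined (g ⁻¹' {g b}) b c → ∃ n, ∀ m, n ≤ m → ∃ w : ℕ → B.carrier,
      w 0 = b ∧ w m = c ∧ (∀ j ≤ m, g (w j) = g b) ∧ ∀ j < m, B.graph.Edge (w j) (w (j + 1)) := by
    intro b c hc
    induction hc with
    | refl => exact ⟨0, fun m _ => ⟨fun _ => b, rfl, rfl, fun _ _ => rfl, fun _ _ => B.graph.refl b⟩⟩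
    | @tail c d _ hcd ih =>
      obtain ⟨n, hn⟩ := ih
      refine ⟨n + 1, fun m hm => ?_⟩
      obtain ⟨m, rfl⟩ : ∃ k, m = k + 1 := ⟨m - 1, by omega⟩
      obtain ⟨w, h0, hm', hw, hE⟩ := hn m (by omega)
      refine ⟨fun j => if j ≤ m then w j else d, by simp [h0], by simp, fun j hj => ?_,
        fun j hj => ?_⟩
      · by_cases h : j ≤ m
        · simp only [h, if_true]; exact hw j h
        · simp only [h, if_false]; exact hcd.2
      · by_cases h : j + 1 ≤ m
        · simp only [h, (by omega : j ≤ m), if_true]; exact hE j h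
        · obtain rfl : j = m := by omega
          simp only [h, le_refl, if_true, if_false, hm']; exact hcd.1
  have hstep : ∀ p : B.carrier × A.carrier, ∃ n, A.graph.Edge (g p.1) p.2 → ∀ m, n ≤ m →
      ∃ w : ℕ → B.carrier, w 0 = p.1 ∧ g (w (m + 1)) = p.2 ∧ (∀ j ≤ m, g (w j) = g p.1) ∧
        ∀ j ≤ m, B.graph.Edge (w j) (w (j + 1)) := by
    rintro ⟨b, v⟩
    by_cases hv : A.graph.Edge (g b) v
    · obtain ⟨c, d, hc, hcd, rfl⟩ := hg.liftsEdges b v hv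
      obtain ⟨n, hn⟩ := hstay b c hc
      refine ⟨n, fun _ m hm => ?_⟩
      obtain ⟨w, h0, hm', hw, hE⟩ := hn m hm
      refine ⟨fun j => if j ≤ m then w j else d, by simp [h0], by simp, fun j hj => ?_,
        fun j hj => ?_⟩
      · simp only [hj, if_true]; exact hw j hj
      · by_cases h : j + 1 ≤ m
        · simp only [h, (by omega : j ≤ m), if_true]; exact hE j h
        · obtain rfl : j = m := by omega
          simp only [h, le_refl, if_true, if_false, hm']; exact hcd
    · exact ⟨0, fun h => absurd h hv⟩
  choose n hn using hstep
  obtain ⟨m, hm⟩ := Finite.exists_le n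
  -- Each step of `q` becomes `m + 1` steps within a fibre and one crossing step. The extra unit
  -- ensures a delay of at least 2, which makes the walk lengths grow.
  refine ⟨m + 2, by omega, fun q b hq hb => ?_⟩
  have hstep' : ∀ (b : B.carrier) (v : A.carrier), ∃ w : ℕ → B.carrier, A.graph.Edge (g b) v →
      w 0 = b ∧ g (w (m + 2)) = v ∧ (∀ j ≤ m + 1, g (w j) = g b) ∧
        ∀ j ≤ m + 1, B.graph.Edge (w j) (w (j + 1)) := by
    intro b v
    by_cases hv : A.graph.Edge (g b) v
    · obtain ⟨w, hw⟩ := hn (b, v) hv (m + 1) ((hm _).trans (Nat.le_succ m))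
      exact ⟨w, fun _ => hw⟩
    · exact ⟨fun _ => b, fun h => absurd h hv⟩
  choose w hw using hstep'
  let β : ℕ → B.carrier := fun i => Nat.rec b (fun i c => w c (q (i + 1)) (m + 2)) i
  have hβs : ∀ i, β (i + 1) = w (β i) (q (i + 1)) (m + 2) := fun _ => rfl
  have hβ : ∀ i, g (β i) = q i := by
    intro i
    induction i with
    | zero => exact hb
    | succ i ih =>
      rw [hβs]
      exact (hw (β i) (q (i + 1)) (by rw [ih]; exact hq i)).2.1
  have hwβ : ∀ i, _ := fun i => hw (β i) (q (i + 1)) (by rw [hβ]; exact hq i)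
  refine ⟨fun k => w (β (k / (m + 2))) (q (k / (m + 2) + 1)) (k % (m + 2)), ?_, fun k => ?_,
    fun k => ?_⟩
  · simp only [Nat.zero_div, Nat.zero_mod]
    exact (hwβ 0).1
  · have hmod : k % (m + 2) < m + 2 := Nat.mod_lt _ (by omega)
    have hE := (hwβ (k / (m + 2))).2.2.2 (k % (m + 2)) (by omega)
    rcases (show k % (m + 2) + 1 < m + 2 ∨ k % (m + 2) + 1 = m + 2 by omega) with h | h
    · have h1 : (k + 1) / (m + 2) = k / (m + 2) := by
        rw [Nat.succ_div_of_not_dvd]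
        intro hd
        have h3 := Nat.mod_eq_zero_of_dvd hd
        rw [Nat.add_mod, Nat.mod_eq_of_lt (by omega : 1 < m + 2), Nat.mod_eq_of_lt h] at h3
        omega
      have h2 : (k + 1) % (m + 2) = k % (m + 2) + 1 := by
        rw [Nat.add_mod, Nat.mod_eq_of_lt (by omega : 1 < m + 2), Nat.mod_eq_of_lt h]
      simp only [h1, h2]
      exact hE
    · have hd : m + 2 ∣ k + 1 := by
        rw [Nat.dvd_iff_mod_eq_zero, Nat.add_mod, Nat.mod_eq_of_lt (by omega : 1 < m + 2), h,
          Nat.mod_self]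
      simp only [Nat.succ_div_of_dvd hd, Nat.mod_eq_zero_of_dvd hd]
      rw [h, ← hβs] at hE
      rw [(hwβ (k / (m + 2) + 1)).1]
      exact hE
  · have hmod : k % (m + 2) < m + 2 := Nat.mod_lt _ (by omega)
    simp only
    rw [(hwβ (k / (m + 2))).2.2.1 _ (by omega), hβ]

/-! ### Transitivity of the edge relation -/

section Limit

variable {V : Type u} [MetricSpace V] [CompactSpace V] {G : TopologicalGraph V}

/-- Two vertices that are not adjacent have non-adjacent images under every epimorphism with small
fibres. -/
theorem exists_not_edge_image {x y : V} (h : ¬ G.Edge x y) :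
    ∃ ε > 0, ∀ (A : FiniteConnectedGraph) (f : V → A.carrier), IsEpimorphism G A.graph f →
      (∀ a, Metric.diam (f ⁻¹' {a}) < ε) → ¬ A.graph.Edge (f x) (f y) := by
  obtain ⟨ε, hε, hball⟩ := Metric.isOpen_iff.1 G.closed.isOpen_compl (x, y) h
  refine ⟨ε, hε, fun A f hf hd hE => ?_⟩
  obtain ⟨x', y', hxy, hx, hy⟩ := hf.edge_surjective _ _ hE
  have hdist : ∀ s t, f s = f t → dist s t < ε := fun s t hst =>
    (Metric.dist_le_diam_of_mem (Metric.isBounded_of_compactSpace) (show s ∈ f ⁻¹' {f t} from hst)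
      rfl).trans_lt (hd _)
  refine hball (show (x', y') ∈ Metric.ball (x, y) ε from ?_) hxy
  rw [Metric.mem_ball, Prod.dist_eq]
  exact max_lt (hdist _ _ hx) (hdist _ _ hy)

/-- If `x` and `z` were not adjacent, a finite quotient with small fibres would keep their images
non-adjacent. Lifted through the subdivision of that quotient, the images of `x`, `y`, `z` cannot be
three distinct vertices, and each coincidence makes the images of `x` and `z` adjacent. -/
theorem IsProjectiveFraisseLimit.trans_edge [TotallyDisconnectedSpace V]
    (hG : IsProjectiveFraisseLimit G) (x y z : V) (hxy : G.Edge x y) (hyz : G.Edge y z) :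
    G.Edge x z := by
  by_contra hxz
  obtain ⟨ε, hε, hsep⟩ := exists_not_edge_image hxz
  obtain ⟨A, f, hf, hd⟩ := hG.refinement ε hε
  have hxz' := hsep A f hf.toIsEpimorphism hd
  obtain ⟨B, g, hg, hB⟩ := A.exists_subdivision
  obtain ⟨h, hh, rfl⟩ := hG.extension A B f g hf hg
  refine hxz' ?_
  have h1 := hf.map_edge _ _ hxy
  have h2 := hf.map_edge _ _ hyz
  by_cases e1 : g (h x) = g (h y)
  · simpa [e1] using h2
  by_cases e2 : g (h y) = g (h z)
  · simpa [e2] using h1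
  · simpa [hB _ _ _ (hh.map_edge _ _ hxy) (hh.map_edge _ _ hyz) e1 e2] using A.graph.refl _

end Limit

/-! ### The topological realization is Hausdorff -/

section Realization

variable {V : Type u} [TopologicalSpace V] {G : TopologicalGraph V}

/-- The projection onto the topological realization. -/
def TopologicalGraph.proj (G : TopologicalGraph V) : V → G.Realization :=
  Quot.mk G.Edge

theorem TopologicalGraph.isQuotientMap_proj (G : TopologicalGraph V) : IsQuotientMap G.proj :=
  isQuotientMap_quot_mk

theorem TopologicalGraph.proj_eq_iff (hG : ∀ x y z, G.Edge x y → G.Edge y z → G.Edge x z)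
    {x y : V} : G.proj x = G.proj y ↔ G.Edge x y := by
  have he : Equivalence G.Edge := ⟨G.refl, fun h => G.symm _ _ h, fun h h' => hG _ _ _ h h'⟩
  exact Quot.eq.trans he.eqvGen_iff

/-- The saturation of a closed set is the projection, along a compact factor, of a closed subset of
`V × V`. -/
theorem TopologicalGraph.isClosedMap_proj [CompactSpace V]
    (hG : ∀ x y z, G.Edge x y → G.Edge y z → G.Edge x z) : IsClosedMap G.proj := by
  intro K hK
  rw [← G.isQuotientMap_proj.isClosed_preimage]
  have : G.proj ⁻¹' (G.proj '' K) = Prod.snd '' ({p : V × V | G.Edge p.1 p.2} ∩ Prod.fst ⁻¹' K) := by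
    ext y
    constructor
    · rintro ⟨x, hx, hxy⟩
      exact ⟨(x, y), ⟨(proj_eq_iff hG).1 hxy, hx⟩, rfl⟩
    · rintro ⟨⟨x, y⟩, ⟨hxy, hx⟩, rfl⟩
      exact ⟨x, hx, (proj_eq_iff hG).2 hxy⟩
  rw [this]
  exact isClosedMap_snd_of_compactSpace _ (G.closed.inter (hK.preimage continuous_fst))

theorem TopologicalGraph.t2Space_realization [CompactSpace V] [T2Space V]
    (hG : ∀ x y z, G.Edge x y → G.Edge y z → G.Edge x z) : T2Space G.Realization := by
  refine ⟨fun a b hab => ?_⟩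
  obtain ⟨x, rfl⟩ := G.isQuotientMap_proj.surjective a
  obtain ⟨y, rfl⟩ := G.isQuotientMap_proj.surjective b
  have hcl : ∀ z, IsClosed (G.proj ⁻¹' {G.proj z}) := fun z => by
    have := isClosedMap_proj hG _ (isClosed_singleton (x := z))
    rw [image_singleton] at this
    exact this.preimage G.isQuotientMap_proj.continuous
  obtain ⟨U, W, hU, hW, hxU, hyW, hUW⟩ := normal_separation (hcl x) (hcl y)
    (Disjoint.preimage _ (disjoint_singleton.2 hab))
  refine ⟨(G.proj '' Uᶜ)ᶜ, (G.proj '' Wᶜ)ᶜ, (isClosedMap_proj hG _ hU.isClosed_compl).isOpen_compl,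
    (isClosedMap_proj hG _ hW.isClosed_compl).isOpen_compl, ?_, ?_, ?_⟩
  · rintro ⟨z, hz, hzx⟩
    exact hz (hxU hzx)
  · rintro ⟨z, hz, hzy⟩
    exact hz (hyW hzy)
  · refine disjoint_left.2 fun c hc1 hc2 => ?_
    obtain ⟨z, rfl⟩ := G.isQuotientMap_proj.surjective c
    have h1 : z ∈ U := by by_contra h; exact hc1 ⟨z, h, rfl⟩
    have h2 : z ∈ W := by by_contra h; exact hc2 ⟨z, h, rfl⟩
    exact disjoint_left.1 hUW h1 h2

end Realization

/-! ### Cantor fans in the realization -/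

section Fan

variable {V : Type u} [MetricSpace V] [CompactSpace V] [TotallyDisconnectedSpace V]
  {G : TopologicalGraph V}

/-- A finite quotient of `G` with a family of walks in it that start at the image of `x`. -/
structure FanStage (G : TopologicalGraph V) (x : V) (S : Type) where
  A : FiniteConnectedGraph
  f : V → A.carrier
  confluent : IsConfluentEpimorphism G A.graph f
  M : ℕ
  p : S → ℕ → A.carrier
  start : ∀ s, p s 0 = f x
  walk : ∀ s, A.graph.IsWalk (p s)

/-- The stage `Y` refines the stage `X`: its walks, indexed by `T`, lift those of `X` with delay `N`,
and up to the length `Y.M` they are not adjacent but at the start. -/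
def FanStage.Refines {x : V} {S T : Type} (ε : ℝ) (r : T → S) (X : FanStage G x S)
    (Y : FanStage G x T) : Prop :=
  ∃ (N : ℕ) (g : Y.A.carrier → X.A.carrier), 2 ≤ N ∧ Y.M = X.M * N ∧ Y.A.Confluent X.A g ∧
    X.f = g ∘ Y.f ∧ (∀ t k, g (Y.p t k) = X.p (r t) (k / N)) ∧
    (∀ a, Metric.diam (Y.f ⁻¹' {a}) < ε) ∧
    ∀ s t k l, k ≤ Y.M → l ≤ Y.M → Y.A.graph.Edge (Y.p s k) (Y.p t l) →
      k ≤ l + 1 ∧ l ≤ k + 1 ∧ (s = t ∨ k = 0 ∨ l = 0)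

/-- A quotient with fibres below a Lebesgue number factors `X.f`, and the walks of `X` lift to it
with a common delay. The product with a cube spreads the lifts apart up to length `X.M * N`, and the
extension property maps `G` confluently onto that product. -/
theorem FanStage.exists_refines (hG : IsProjectiveFraisseLimit G) {x : V} {S T : Type} [Finite T]
    {ε : ℝ} (hε : 0 < ε) (r : T → S) (X : FanStage G x S) :
    ∃ Y : FanStage G x T, X.Refines ε r Y := by
  obtain ⟨δ, hδ, hleb⟩ := lebesgue_number_lemma_of_metric (s := (univ : Set V)) isCompact_univ
    (c := fun a => X.f ⁻¹' {a}) (fun a => (isOpen_discrete _).preimage X.confluent.continuous)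
    (fun y _ => mem_iUnion.2 ⟨X.f y, rfl⟩)
  have hδ' : ∀ y z, dist y z < δ → X.f y = X.f z := fun y z hyz => by
    obtain ⟨a, ha⟩ := hleb z (mem_univ z)
    exact (ha (Metric.mem_ball.2 hyz) : X.f y = a).trans (ha (Metric.mem_ball_self hδ) : _ = a).symm
  obtain ⟨A, f, hf, hd⟩ := hG.refinement (min δ ε) (lt_min hδ hε)
  have hfac : X.f = (X.f ∘ Function.surjInv hf.surjective) ∘ f := by
    funext y
    refine hδ' _ _ ((Metric.dist_le_diam_of_mem Metric.isBounded_of_compactSpace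
      (show y ∈ f ⁻¹' {f y} from rfl) ?_).trans_lt ((hd (f y)).trans_le (min_le_left _ _)))
    exact Function.surjInv_eq hf.surjective (f y)
  generalize X.f ∘ Function.surjInv hf.surjective = g at hfac
  have hg : A.Confluent X.A g := X.confluent.of_comp hf.toIsEpimorphism hfac X.A.connected
  obtain ⟨N, hN, hlift⟩ := FiniteConnectedGraph.Confluent.exists_walk_lift hg
  choose q hq0 hqw hqg using fun t => hlift (X.p (r t)) (f x) (X.walk _)
    (by rw [X.start, hfac]; rfl)
  obtain ⟨B, k, hk, hfan⟩ := A.exists_fan_lift T (X.M * N)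
  obtain ⟨h, hh, hfk⟩ := hG.extension A B f k hf hk
  obtain ⟨p, hp0, hpq, hpw, hpE⟩ := hfan q (h x) (fun t => (hq0 t).trans (congrFun hfk x)) hqw
  refine ⟨⟨B, h, hh, X.M * N, p, hp0, hpw⟩, N, g ∘ k, hN, rfl, hg.comp hk, ?_, fun t i => ?_,
    fun b => ?_, hpE⟩
  · rw [Function.comp_assoc, ← hfk, ← hfac]
  · rw [Function.comp_apply, hpq, hqg]
  · refine lt_of_le_of_lt (Metric.diam_mono ?_ Metric.isBounded_of_compactSpace)
      ((hd (k b)).trans_le (min_le_right _ _))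
    rintro y rfl
    exact congrFun hfk y

/-- Finite quotients of `G` with fans of walks at `x` that converge to a Cantor fan. -/
theorem exists_fan_system (hG : IsProjectiveFraisseLimit G) (x : V) :
    ∃ (A : ℕ → FiniteConnectedGraph) (f : ∀ n, V → (A n).carrier) (M N : ℕ → ℕ)
      (p : ∀ n, (ℕ → Bool) → ℕ → (A n).carrier) (g : ∀ n, (A (n + 1)).carrier → (A n).carrier),
      (∀ n, IsConfluentEpimorphism G (A n).graph (f n)) ∧
      (∀ n a, Metric.diam (f n ⁻¹' {a}) < 1 / ((n : ℝ) + 1)) ∧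
      (∀ n, (A (n + 1)).Confluent (A n) (g n)) ∧ (∀ n, f n = g n ∘ f (n + 1)) ∧
      (∀ n, 2 ≤ N n) ∧ (∀ n, M (n + 1) = M n * N n) ∧ 0 < M 0 ∧
      (∀ n c, p n c 0 = f n x) ∧ (∀ n c, (A n).graph.IsWalk (p n c)) ∧
      (∀ n c k, g n (p (n + 1) c k) = p n c (k / N n)) ∧
      (∀ n c d, (∀ i ≤ n, c i = d i) → p n c = p n d) ∧
      ∀ n c d k l, k ≤ M n → l ≤ M n → (A n).graph.Edge (p n c k) (p n d l) →
        k ≤ l + 1 ∧ l ≤ k + 1 ∧ ((∀ i ≤ n, c i = d i) ∨ k = 0 ∨ l = 0) := by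
  obtain ⟨A₀, f₀, hf₀, -⟩ := hG.refinement 1 one_pos
  -- The empty word indexes one constant walk; its length 1 is a seed for the later products.
  let X₀ : FanStage G x (Fin 0 → Bool) :=
    ⟨A₀, f₀, hf₀, 1, fun _ _ => f₀ x, fun _ => rfl, fun _ _ => A₀.graph.refl _⟩
  have hstep : ∀ (n : ℕ) (X : FanStage G x (Fin n → Bool)),
      ∃ Y : FanStage G x (Fin (n + 1) → Bool),
        X.Refines (1 / ((n : ℝ) + 1)) (fun t i => t i.castSucc) Y :=
    fun n X => X.exists_refines hG Nat.one_div_pos_of_nat _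
  choose Y hY using hstep
  let X : ∀ n, FanStage G x (Fin n → Bool) := fun n => Nat.rec X₀ Y n
  have hX : ∀ n, (X n).Refines (1 / ((n : ℝ) + 1)) (fun t i => t i.castSucc) (X (n + 1)) :=
    fun n => hY n (X n)
  choose N g hN hM hg hfg hp hd hE using hX
  have hres : ∀ (n : ℕ) (c d : ℕ → Bool),
      ((fun i : Fin (n + 1) => c i) = fun i : Fin (n + 1) => d i) ↔
      ∀ i ≤ n, c i = d i := fun n c d => by
    refine ⟨fun h i hi => congrFun h ⟨i, by omega⟩, fun h => funext fun i => h i (by omega)⟩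
  -- The shift by one skips the seed, which has neither small fibres nor separated walks, and words
  -- of length `n + 1` record exactly the coordinates `i ≤ n`.
  refine ⟨fun n => (X (n + 1)).A, fun n => (X (n + 1)).f, fun n => (X (n + 1)).M,
    fun n => N (n + 1), fun n c => (X (n + 1)).p fun i => c i, fun n => g (n + 1),
    fun n => (X (n + 1)).confluent, hd, fun n => hg (n + 1), fun n => hfg (n + 1),
    fun n => hN (n + 1), fun n => hM (n + 1), ?_, fun n c => (X (n + 1)).start _,
    fun n c => (X (n + 1)).walk _, fun n c k => hp (n + 1) _ k,
    fun n c d h => congrArg (X (n + 1)).p ((hres n c d).2 h), fun n c d k l hk hl h => ?_⟩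
  · have h1 : 2 ≤ (X 1).M := (hN 0).trans_eq (Nat.one_mul _).symm |>.trans_eq (hM 0).symm
    exact two_pos.trans_le h1
  · obtain ⟨h1, h2, h3⟩ := hE n _ _ k l hk hl h
    exact ⟨h1, h2, h3.imp_left (hres n c d).1⟩

/-- A continuous injection of the Cantor fan into a Hausdorff space gives an embedded fan. -/
theorem isTopOfCantorFan_of_map {X : Type u} [TopologicalSpace X] [T2Space X] {x : X}
    (φ : (ℕ → Bool) × unitInterval → X) (hφ : Continuous φ) (htop : ∀ c, φ (c, 1) = x)
    (hinj : ∀ a b, φ a = φ b → coneSetoid a b) : IsTopOfCantorFan x := by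
  have : CompactSpace CantorFan := inferInstanceAs (CompactSpace (Quotient coneSetoid))
  let Φ : CantorFan → X := Quotient.lift φ (by
    rintro a b (h | ⟨h1, h2⟩)
    · rw [h]
    · obtain ⟨c, s⟩ := a
      obtain ⟨d, t⟩ := b
      obtain rfl : s = 1 := h1
      obtain rfl : t = 1 := h2
      rw [htop, htop])
  have hΦ : Continuous Φ := hφ.quotient_lift _
  have hΦi : Function.Injective Φ := by
    intro a b
    induction a using Quotient.inductionOn
    induction b using Quotient.inductionOn
    exact fun h => Quotient.sound (hinj _ _ h)
  exact ⟨range Φ, (hΦ.isClosedEmbedding hΦi).isEmbedding.toHomeomorph, htop _⟩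

theorem IsProjectiveFraisseLimit.isTopOfCantorFan (hG : IsProjectiveFraisseLimit G)
    (x : G.Realization) : IsTopOfCantorFan x := by
  have htrans := hG.trans_edge
  have := TopologicalGraph.t2Space_realization htrans
  obtain ⟨x, rfl⟩ := G.isQuotientMap_proj.surjective x
  obtain ⟨A, f, M, N, p, g, hf, hd, hg, hfg, hN, hM, hM0, hp0, hpw, hpg, hploc, hpE⟩ :=
    exists_fan_system hG x
  have hMlt : ∀ n, n < M n := fun n => by
    induction n with
    | zero => exact hM0
    | succ n ih =>
      have := Nat.mul_le_mul_left (M n) (hN n)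
      rw [hM]
      omega
  have hE_iff : ∀ y z, G.Edge y z ↔ ∀ n, (A n).graph.Edge (f n y) (f n z) := by
    refine fun y z => ⟨fun h n => (hf n).map_edge _ _ h, fun h => ?_⟩
    by_contra hyz
    obtain ⟨ε, hε, hsep⟩ := exists_not_edge_image hyz
    obtain ⟨n, hn⟩ := exists_nat_one_div_lt hε
    exact hsep _ _ (hf n).toIsEpimorphism (fun a => (hd n a).trans hn) (h n)
  have hE_anti : ∀ n y z, (A (n + 1)).graph.Edge (f (n + 1) y) (f (n + 1) z) →
      (A n).graph.Edge (f n y) (f n z) := fun n y z h => by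
    rw [hfg n]
    exact (hg n).map_edge _ _ h
  -- Time runs backwards, as the top `t = 1` is the start of the walks. Rounding down proportional
  -- positions is compatible with the delays, so the selected vertices are compatible between
  -- stages.
  let pos : ℕ → unitInterval → ℕ := fun n t => ⌊(1 - (t : ℝ)) * M n⌋₊
  have hpos_le : ∀ n t, pos n t ≤ M n := fun n t => by
    refine Nat.floor_le_of_le ?_
    have := t.2.1
    nlinarith [(Nat.cast_nonneg (M n) : (0 : ℝ) ≤ M n)]
  have hpos_div : ∀ n t, pos (n + 1) t / N n = pos n t := fun n t => by
    have hN0 : (N n : ℝ) ≠ 0 := by have := hN n; positivity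
    change ⌊(1 - (t : ℝ)) * M (n + 1)⌋₊ / N n = ⌊(1 - (t : ℝ)) * M n⌋₊
    rw [← Nat.floor_div_natCast, hM, Nat.cast_mul, ← mul_assoc, mul_div_cancel_right₀ _ hN0]
  have hpos_near : ∀ n (s t : unitInterval), |(s : ℝ) - t| * M n < 1 → pos n s ≤ pos n t + 1 := by
    intro n s t h
    have hM' : (0 : ℝ) ≤ M n := Nat.cast_nonneg _
    change _ ≤ ⌊(1 - (t : ℝ)) * M n⌋₊ + 1
    rw [← Nat.floor_add_one (mul_nonneg (sub_nonneg.2 t.2.2) hM')]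
    refine Nat.floor_le_floor ?_
    nlinarith [mul_le_mul_of_nonneg_right (neg_abs_le ((s : ℝ) - t)) hM']
  have hΨ : ∀ (c : ℕ → Bool) (t : unitInterval), ∃ y, ∀ n, f n y = p n c (pos n t) := by
    intro c t
    obtain ⟨y, hy⟩ := IsCompact.nonempty_iInter_of_sequence_nonempty_isCompact_isClosed
      (fun n => f n ⁻¹' {p n c (pos n t)})
      (fun n y hy => by
        change f n y = _
        rw [hfg n, Function.comp_apply, show f (n + 1) y = _ from hy, hpg, hpos_div])
      (fun n => (hf n).surjective _)
      (((isClosed_discrete _).preimage (hf 0).continuous).isCompact)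
      (fun n => (isClosed_discrete _).preimage (hf n).continuous)
    exact ⟨y, mem_iInter.1 hy⟩
  choose Ψ hΨ using hΨ
  refine isTopOfCantorFan_of_map (fun a => G.proj (Ψ a.1 a.2)) ?_ ?_ ?_
  · refine continuous_def.2 fun U hU => isOpen_iff_mem_nhds.2 ?_
    rintro ⟨c, t⟩ hct
    -- `Ψ` itself jumps between adjacent vertices. The finite-stage neighbourhoods of `Ψ c t`
    -- decrease to its edge class, so one of them lies in `G.proj ⁻¹' U`.
    obtain ⟨n, hn⟩ := exists_subset_nhds_of_isCompact'
      (V := fun n => f n ⁻¹' {a | (A n).graph.Edge (f n (Ψ c t)) a})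
      (directed_of_isDirected_le (antitone_nat_of_succ_le fun n y hy => hE_anti n _ _ hy))
      (fun n => ((isClosed_discrete _).preimage (hf n).continuous).isCompact)
      (fun n => (isClosed_discrete _).preimage (hf n).continuous)
      (U := G.proj ⁻¹' U) (by
        intro y hy
        have hy' : G.Edge (Ψ c t) y := (hE_iff _ _).2 (mem_iInter.1 hy)
        refine (hU.preimage G.isQuotientMap_proj.continuous).mem_nhds ?_
        rw [mem_preimage, ← (TopologicalGraph.proj_eq_iff htrans).2 hy']
        exact hct)
    have h1 : ∀ᶠ a : (ℕ → Bool) × unitInterval in 𝓝 (c, t), ∀ i ∈ Iic n, a.1 i = c i := by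
      refine (finite_Iic n).eventually_all.2 fun i _ => ?_
      have : Continuous fun a : (ℕ → Bool) × unitInterval => a.1 i := by fun_prop
      exact this.continuousAt.eventually_mem ((isOpen_discrete {c i}).mem_nhds (mem_singleton _))
    have h2 : ∀ᶠ a : (ℕ → Bool) × unitInterval in 𝓝 (c, t), |(a.2 : ℝ) - t| * M n < 1 := by
      have : Continuous fun a : (ℕ → Bool) × unitInterval => |(a.2 : ℝ) - t| * M n := by fun_prop
      exact this.continuousAt.eventually_lt continuousAt_const (by simp)
    filter_upwards [h1, h2] with a ha1 ha2
    refine hn ?_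
    change (A n).graph.Edge (f n (Ψ c t)) (f n (Ψ a.1 a.2))
    rw [hΨ, hΨ, hploc n a.1 c ha1]
    exact (hpw n c).edge (hpos_near _ _ _ (by rwa [abs_sub_comm])) (hpos_near _ _ _ ha2)
  · intro c
    refine (TopologicalGraph.proj_eq_iff htrans).2 ((hE_iff _ _).2 fun n => ?_)
    have : pos n 1 = 0 := by simp [pos]
    rw [hΨ, this, hp0]
    exact (A n).graph.refl _
  · rintro ⟨c, s⟩ ⟨d, t⟩ h
    have hcd := fun n => (hE_iff _ _).1 ((TopologicalGraph.proj_eq_iff htrans).1 h) n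
    simp only [hΨ] at hcd
    have key := fun n => hpE n c d _ _ (hpos_le n s) (hpos_le n t) (hcd n)
    -- Walk lengths tend to infinity; a real gap above 2 leaves an integer gap of at least 2 after
    -- rounding down.
    have hfar : ∀ s t : unitInterval, (s : ℝ) < t → ∃ n, pos n t + 1 < pos n s := by
      intro s t hst
      obtain ⟨n, hn⟩ := exists_nat_gt (2 / ((t : ℝ) - s))
      rw [div_lt_iff₀ (sub_pos.2 hst)] at hn
      have hM' : (n : ℝ) ≤ M n := by exact_mod_cast (hMlt n).le
      refine ⟨n, Nat.le_floor ?_⟩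
      have hfl : (pos n t : ℝ) ≤ (1 - (t : ℝ)) * M n :=
        Nat.floor_le (mul_nonneg (sub_nonneg.2 t.2.2) (Nat.cast_nonneg _))
      push_cast
      nlinarith [mul_le_mul_of_nonneg_right hM' (sub_pos.2 hst).le]
    have hst : s = t := by
      by_contra hne
      rcases lt_or_gt_of_ne hne with h | h
      · obtain ⟨n, hn⟩ := hfar s t h
        exact absurd (key n).1 (by omega)
      · obtain ⟨n, hn⟩ := hfar t s h
        exact absurd (key n).2.1 (by omega)
    subst hst
    by_cases hs : s = 1
    · exact Or.inr ⟨hs, hs⟩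
    refine Or.inl (Prod.ext (funext fun i => ?_) rfl)
    have hs1 : (s : ℝ) < (1 : unitInterval) := lt_of_le_of_ne s.2.2 fun h => hs (Subtype.ext h)
    obtain ⟨n, hn⟩ := hfar s 1 hs1
    -- A position off the start stays off it at later stages, so the separation of branches applies
    -- at a stage that sees coordinate `i`.
    have hpos : ∀ m, n ≤ m → pos m s ≠ 0 := fun m hm => by
      induction m, hm using Nat.le_induction with
      | base => omega
      | succ m hm ih =>
        intro h0
        exact ih (by rw [← hpos_div, h0, Nat.zero_div])
    have := hpos (max n i) (le_max_left _ _)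
    exact ((key (max n i)).2.2.resolve_right (by simpa using this)) i (le_max_right _ _)

end Fan

end ConfluentGraph

theorem mainTheorem6 :
    (∃ (V : Type) (_ : MetricSpace V) (_ : CompactSpace V) (_ : TotallyDisconnectedSpace V)
      (G : ConfluentGraph.TopologicalGraph V), ConfluentGraph.IsProjectiveFraisseLimit G) ∧
    ∀ {V : Type*} [MetricSpace V] [CompactSpace V] [TotallyDisconnectedSpace V]
      (G : ConfluentGraph.TopologicalGraph V), ConfluentGraph.IsProjectiveFraisseLimit G →
      (∀ x y z, G.Edge x y → G.Edge y z → G.Edge x z) ∧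
      ∀ x : G.Realization, ConfluentGraph.IsTopOfCantorFan x :=
  ⟨ConfluentGraph.exists_isProjectiveFraisseLimit, fun _ hG =>
    ⟨hG.trans_edge, hG.isTopOfCantorFan⟩⟩
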